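/- Let $n\ge 3$. Let $\mathfrak{sp}(n,\mathbb R)\subset\mathfrak{gl}_{2n}(\mathbb R)$ be the Lie algebra of matrices $M$ with $M^T\widetilde J+\widetilde JM=0$, $\widetilde J=\begin{bmatrix}0&I_n\\-I_n&0\end{bmatrix}$, and let $\mathfrak{so}(2n,2n)\subset\mathfrak{gl}_{4n}(\mathbb R)$ be the Lie algebra of matrices $M$ with $M^TJ+JM=0$, $J=\begin{bmatrix}0&I_{2n}\\I_{2n}&0\end{bmatrix}$; $\mathbb R^{2n,2n}$ denotes $\mathbb R^{4n}$ with the symmetric bilinear form given by $J$. An embedding is an injective homomorphism of real Lie algebras $\mathfrak{sp}(n,\mathbb R)\oplus\mathfrak{sp}(1,\mathbb R)\to\mathfrak{so}(2n,2n)$. (1) The formula $$\begin{bmatrix}A&B\\C&-A^T\end{bmatrix}+\begin{bmatrix}a&b\\c&-a\end{bmatrix}\longmapsto\begin{bmatrix}A+aI_n&B&0&bI_n\\C&-A^T+aI_n&-bI_n&0\\0&-cI_n&-A^T-aI_n&-C\\cI_n&0&-B&A-aI_n\end{bmatrix}$$ defines an embedding of $\mathfrak{sp}(n,\mathbb R)\oplus\mathfrak{sp}(1,\mathbb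 R)$ into $\mathfrak{so}(2n,2n)$. (2) This embedding is unique up to isomorphism: for any two embeddings $\varphi,\psi$ there is an automorphism $\theta$ of the Lie algebra $\mathfrak{so}(2n,2n)$ with $\theta\circ\varphi=\psi$, and $\theta$ can be chosen of the form $X\mapsto gXg^{-1}$ with $g\in GL_{4n}(\mathbb R)$ an isometry or an anti-isometry of $\mathbb R^{2n,2n}$ (that is, $g^TJg=J$ or $g^TJg=-J$). Moreover, there are an isometry $g$ of $\mathbb R^{2n,2n}$ and an automorphism $\alpha$ of $\mathfrak{sp}(n,\mathbb R)\oplus\mathfrak{sp}(1,\mathbb R)$ with $\psi(\alpha(x))=g\,\varphi(x)\,g^{-1}$ for all $x$; in particular the images of $\varphi$ and $\psi$ are conjugate under $O(2n,2n)$. (3) Under any such embedding, $\mathbb R^{2n,2n}$ is an irreducible $\big(\mathfrak{sp}(n,\mathbb R)\oplus\mathfrak{sp}(1,\mathbb R)\big)$-module. -/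

import Mathlib

attribute [local instance 100] LieRing.ofAssociativeRing

namespace SplitInclusion

/-- The index set of the coordinates of `ℝ²ⁿ`, in two blocks of length `n`. -/
abbrev Idx (n : ℕ) : Type := Fin n ⊕ Fin n

/-- The index set of the coordinates of `ℝ⁴ⁿ = ℝ²ⁿ ⊕ ℝ²ⁿ`. -/
abbrev DIdx (n : ℕ) : Type := Idx n ⊕ Idx n

/-- `𝔰𝔭(n, ℝ)`: the real `2n × 2n` matrices `M` with `Mᵀ J + J M = 0`, where `J` is the standard
symplectic matrix. -/
abbrev spR (n : ℕ) : LieSubalgebra ℝ (Matrix (Idx n) (Idx n) ℝ) :=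
  LieAlgebra.Symplectic.sp (Fin n) ℝ

/-- The symmetric matrix `[0, I₂ₙ; I₂ₙ, 0]`, whose bilinear form on `ℝ⁴ⁿ` has signature
`(2n, 2n)`. The space `ℝ⁴ⁿ` with this form is `ℝ^{2n,2n}`. -/
abbrev splitForm (n : ℕ) : Matrix (DIdx n) (DIdx n) ℝ :=
  LieAlgebra.Orthogonal.JD (Idx n) ℝ

/-- `𝔰𝔬(2n, 2n)`: the real `4n × 4n` matrices `M` with `Mᵀ J + J M = 0` for `J = splitForm n`. -/
abbrev soSplit (n : ℕ) : LieSubalgebra ℝ (Matrix (DIdx n) (DIdx n) ℝ) :=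
  LieAlgebra.Orthogonal.typeD (Idx n) ℝ

/-- The direct sum of Lie algebras `𝔰𝔭(n, ℝ) ⊕ 𝔰𝔭(1, ℝ)`, with componentwise bracket. -/
abbrev SpSp (n : ℕ) : Type := ↥(spR n) × ↥(spR 1)

/-- For `M = [A, B; C, -Aᵀ]` in `𝔰𝔭(n, ℝ)` and `N = [a, b; c, -a]` in `𝔰𝔭(1, ℝ)` this is
```
[ A + aI   B         0         bI     ]
[ C        -Aᵀ + aI  -bI       0      ]
[ 0        -cI       -Aᵀ - aI  -C     ]
[ cI       0         -B        A - aI ]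
```
that is, `[M + aI, bK; -cK, -(M + aI)ᵀ]` with `K = [0, I; -I, 0]`. -/
def inclusionMatrix {n : ℕ} (M : Matrix (Idx n) (Idx n) ℝ) (N : Matrix (Idx 1) (Idx 1) ℝ) :
    Matrix (DIdx n) (DIdx n) ℝ :=
  let a := N (Sum.inl 0) (Sum.inl 0)
  let b := N (Sum.inl 0) (Sum.inr 0)
  let c := N (Sum.inr 0) (Sum.inl 0)
  let K : Matrix (Idx n) (Idx n) ℝ := Matrix.fromBlocks 0 1 (-1) 0
  Matrix.fromBlocks (M + a • 1) (b • K) (-(c • K)) (-(M + a • 1).transpose)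

/-- The space `ℝ^{2n,2n}`, regarded as a `𝔰𝔭(n, ℝ) ⊕ 𝔰𝔭(1, ℝ)`-module through the homomorphism
`φ` into `𝔰𝔬(2n, 2n)`: an element `x` acts on column vectors by the matrix `φ x`. -/
def ModuleVia {n : ℕ} (_φ : SpSp n →ₗ⁅ℝ⁆ ↥(soSplit n)) : Type := DIdx n → ℝ

section

variable {n : ℕ} (φ : SpSp n →ₗ⁅ℝ⁆ ↥(soSplit n))

instance : AddCommGroup (ModuleVia φ) := inferInstanceAs (AddCommGroup (DIdx n → ℝ))

instance : Module ℝ (ModuleVia φ) := inferInstanceAs (Module ℝ (DIdx n → ℝ))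

instance : LieRingModule (SpSp n) (ModuleVia φ) :=
  LieRingModule.compLieHom (DIdx n → ℝ) φ

instance : LieModule ℝ (SpSp n) (ModuleVia φ) :=
  LieModule.compLieHom (DIdx n → ℝ) φ

theorem ModuleVia.lie_eq (x : SpSp n) (v : ModuleVia φ) :
    ⁅x, v⁆ = ((φ x : Matrix (DIdx n) (DIdx n) ℝ).mulVec v : DIdx n → ℝ) := rfl

end

end SplitInclusion

/-! An embedding makes `V = ℝ⁴ⁿ` a module over `𝔰𝔭(n) ⊕ 𝔰𝔭(1)`, and the point is that dimension and
invariant form leave only one such module, `ℝ²ⁿ ⊗ ℝ²`.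

For `n ≥ 3` the weights of `𝔰𝔭(n)` on a space of dimension at most `4n` are among `0` and `± eᵢ`.
Indeed, by `𝔰𝔩₂`-theory the weights are integral and closed under subtracting a root with which they
pair positively; any other weight descends to some `± eᵢ ± eⱼ` or `± eᵢ ± eⱼ ± eₖ`, and these force
more than `4n` weights (`RootClosed.eq_zero_or_single`). Complete reducibility is not used: the
action of the Cartan subalgebra is controlled through generalized eigenspaces, and `D³ = D` for its
basis elements is a conclusion (`SpRelations.diag_cubed`).

Let `U` be the space of vectors of weight `eₒ`. The root vectors give an injection `ℝ²ⁿ ⊗ U → V`, so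
`dim U ≤ 2`. The form `(u, u') ↦ B(u, c u')` on `U`, with `c` the root vector for `-2eₒ`, is
nondegenerate and alternating, because `B` is symmetric and `c` is skew for it. As `U ≠ 0`, its
dimension is `2` and `V = ℝ²ⁿ ⊗ U` (`StandardSp.finrank_topSpace`). The commuting algebra `𝔰𝔭(1)`
acts on `U` nontrivially, hence as on `ℝ²`. This yields a nonzero intertwiner `g` from the standard
embedding (`exists_intertwiner`).

The standard embedding generates the full matrix algebra (`eq_top_of_stdEmbedding_mem`), so its
module is irreducible with scalar commutant. Thus `g` is invertible, and it carries the form to a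
multiple `r` of itself; after scaling, `r = ±1`. The matrix `diag(I, -I)` has multiplier `-1` and
acts on the standard embedding as an automorphism of `𝔰𝔭(1)`, so a wrong sign can be moved to the
source. -/

namespace SplitInclusion

open Module

/-! ### Finite-dimensional representations of `𝔰𝔩₂` over the reals, without complete reducibility.
-/

section SlTriple

variable {V : Type*} [AddCommGroup V] [Module ℝ V]

/-- Three endomorphisms satisfying the relations of the standard basis of `𝔰𝔩₂`; the zero triple is
allowed. -/
structure SlTriple (h e f : End ℝ V) : Prop where
  ef : e * f - f * e = h
  he : h * e - e * h = (2 : ℝ) • e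
  hf : h * f - f * h = -((2 : ℝ) • f)

theorem aeval_X_sub_C (h : End ℝ V) (c : ℝ) :
    (Polynomial.X - Polynomial.C c).aeval h = h - c • 1 := by
  rw [map_sub, Polynomial.aeval_X, Polynomial.aeval_C, Algebra.algebraMap_eq_smul_one]

namespace SlTriple

variable {h e f : End ℝ V}

theorem symm (t : SlTriple h e f) : SlTriple (-h) f e where
  ef := by rw [← t.ef]; abel
  he := by
    have := t.hf
    rw [neg_mul, mul_neg, ← neg_inj, ← this]; abel
  hf := by
    have := t.he
    rw [neg_mul, mul_neg, ← this]; abel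

theorem h_mul_e (t : SlTriple h e f) (c : ℝ) :
    (h - (c + 2) • 1) * e = e * (h - c • 1) := by
  have := t.he
  rw [sub_eq_iff_eq_add] at this
  rw [sub_mul, mul_sub, this, smul_mul_assoc, mul_smul_comm, one_mul, mul_one]
  module

theorem h_mul_e_pow (t : SlTriple h e f) (c : ℝ) (k : ℕ) :
    (h - (c + 2 * k) • 1) * e ^ k = e ^ k * (h - c • 1) := by
  induction k generalizing c with
  | zero => simp
  | succ k ih =>
    have := t.h_mul_e c
    rw [pow_succ, mul_assoc, ← this, ← mul_assoc, ← mul_assoc, ← ih]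
    congr 4
    push_cast; ring

/-- Since `[h, eᵏ] = 2k eᵏ`, nonvanishing of all powers would give `ad h` on the finite-dimensional
space `End V` the infinitely many eigenvalues `2k`. -/
theorem e_isNilpotent [FiniteDimensional ℝ V] (t : SlTriple h e f) : IsNilpotent e := by
  by_contra hn
  let T : End ℝ (End ℝ V) := LinearMap.mulLeft ℝ h - LinearMap.mulRight ℝ h
  have hT : ∀ k : ℕ, T.HasEigenvalue (2 * k : ℝ) := by
    intro k
    refine End.hasEigenvalue_of_hasEigenvector (x := e ^ k) ⟨?_, fun h0 ↦ hn ⟨k, h0⟩⟩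
    rw [End.mem_eigenspace_iff]
    have := t.h_mul_e_pow 0 k
    simp only [zero_smul, sub_zero, zero_add, sub_mul, smul_mul_assoc, one_mul] at this
    simp only [T, LinearMap.sub_apply, LinearMap.mulLeft_apply, LinearMap.mulRight_apply]
    rw [← this]; abel
  have hfin := T.finite_hasEigenvalue
  refine Set.infinite_of_injective_forall_mem (f := fun k : ℕ ↦ (2 * k : ℝ)) ?_ hT hfin
  intro a b hab
  simpa using hab

theorem f_isNilpotent [FiniteDimensional ℝ V] (t : SlTriple h e f) : IsNilpotent f :=
  t.symm.e_isNilpotent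

theorem e_mul_f_pow (t : SlTriple h e f) (k : ℕ) :
    e * f ^ (k + 1) = f ^ (k + 1) * e + ((k : ℝ) + 1) • (f ^ k * (h - (k : ℝ) • 1)) := by
  induction k with
  | zero => simp [← t.ef]
  | succ k ih =>
    have h1 : h * f = f * h - (2 : ℝ) • f := by
      have := t.hf; rw [sub_eq_iff_eq_add] at this; rw [this]; abel
    have h2 : e * f = f * e + h := by rw [← t.ef]; abel
    rw [pow_succ f (k + 1), ← mul_assoc, ih, add_mul, mul_assoc, h2, smul_mul_assoc, mul_assoc (f ^ k),
      sub_mul, h1, smul_mul_assoc, one_mul]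
    simp only [mul_add, mul_sub, mul_smul_comm, smul_sub, smul_smul, mul_one, ← mul_assoc, ← pow_succ]
    push_cast
    module

/-- Commuting one `e` through `f ^ (k + 1)` leaves `(k + 1) fᵏ (h - k) v`, and `(h - k) v` is again
killed by `e`. A polynomial in `h` appears instead of a scalar because `v` need not be an
eigenvector. -/
theorem e_pow_f_pow (t : SlTriple h e f) {v : V} (hv : e v = 0) (k : ℕ) :
    (e ^ k * f ^ k) v =
      (k.factorial : ℝ) • (∏ j ∈ Finset.range k, (Polynomial.X - Polynomial.C (j : ℝ))).aeval h v := by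
  induction k generalizing v with
  | zero => simp
  | succ k ih =>
    have h1 : e ((h - (k : ℝ) • 1) v) = 0 := by
      have := congrArg (· v) (t.h_mul_e (k : ℝ))
      simp only [End.mul_apply, hv, map_zero] at this
      exact this.symm
    rw [pow_succ e, mul_assoc, t.e_mul_f_pow, mul_add, LinearMap.add_apply, ← mul_assoc,
      End.mul_apply _ e, hv, map_zero, zero_add, mul_smul_comm, ← mul_assoc, LinearMap.smul_apply,
      End.mul_apply, ih h1, Finset.prod_range_succ, map_mul, End.mul_apply, smul_smul,
      Nat.factorial_succ, aeval_X_sub_C]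
    push_cast
    rfl

/-- On the kernel of `e` the endomorphism `h` is annihilated by a product of factors `h - j`. -/
theorem exists_prod_apply_eq_zero [FiniteDimensional ℝ V] (t : SlTriple h e f) :
    ∃ N : ℕ, ∀ v : V, e v = 0 →
      (∏ j ∈ Finset.range N, (Polynomial.X - Polynomial.C (j : ℝ))).aeval h v = 0 := by
  obtain ⟨N, hN⟩ := t.f_isNilpotent
  refine ⟨N, fun v hv ↦ ?_⟩
  have := t.e_pow_f_pow hv N
  rw [hN, mul_zero, LinearMap.zero_apply, eq_comm, smul_eq_zero] at this
  exact this.resolve_left (by positivity)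

theorem exists_nat_of_primitive [FiniteDimensional ℝ V] (t : SlTriple h e f) {v : V} {c : ℝ}
    (hv : v ≠ 0) (hc : h v = c • v) (he : e v = 0) : ∃ k : ℕ, c = k := by
  obtain ⟨N, hN⟩ := t.exists_prod_apply_eq_zero
  have := hN v he
  rw [End.aeval_apply_of_mem_apply_eq_smul hc, smul_eq_zero, or_iff_left hv,
    Polynomial.eval_prod, Finset.prod_eq_zero_iff] at this
  obtain ⟨k, -, hk⟩ := this
  exact ⟨k, by simpa [sub_eq_zero] using hk⟩

/-- If `f v = 0`, then `v` is primitive for the opposite triple `(-h, f, e)` with the negative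
eigenvalue `-c`. This is the source of the closure property of weights. -/
theorem f_apply_ne_zero [FiniteDimensional ℝ V] (t : SlTriple h e f) {v : V} {c : ℝ}
    (hv : v ≠ 0) (hc : h v = c • v) (hpos : 0 < c) : f v ≠ 0 := by
  intro hf
  obtain ⟨k, hk⟩ := t.symm.exists_nat_of_primitive (c := -c) hv (by simp [hc]) hf
  have : (0 : ℝ) ≤ k := k.cast_nonneg
  linarith

/-- The last nonzero `eᵐ v` is primitive, with eigenvalue `c + 2m`. -/
theorem exists_int_of_eigenvector [FiniteDimensional ℝ V] (t : SlTriple h e f) {v : V} {c : ℝ}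
    (hv : v ≠ 0) (hc : h v = c • v) : ∃ k : ℤ, c = k := by
  classical
  obtain ⟨N, hN⟩ := t.e_isNilpotent
  have hex : ∃ N : ℕ, (e ^ N) v = 0 := ⟨N, by simp [hN]⟩
  obtain ⟨m, hm⟩ : ∃ m, Nat.find hex = m + 1 := by
    refine Nat.exists_eq_succ_of_ne_zero fun h0 ↦ hv ?_
    simpa [h0] using Nat.find_spec hex
  have h1 : (e ^ m) v ≠ 0 := Nat.find_min hex (by lia)
  have h2 : e ((e ^ m) v) = 0 := by
    rw [← End.mul_apply, ← pow_succ', ← hm]; exact Nat.find_spec hex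
  have h3 : h ((e ^ m) v) = (c + 2 * m) • (e ^ m) v := by
    have := congrArg (· v) (t.h_mul_e_pow c m)
    simpa [hc, sub_eq_zero] using this
  obtain ⟨k, hk⟩ := t.exists_nat_of_primitive h1 h3 h2
  exact ⟨k - 2 * m, by push_cast; linarith⟩

end SlTriple

/-- On the generalized eigenspaces for `μ ≠ c` the map `h - c` is bijective. Hence `(h - c) v`
differs from some `(h - c) m`, with `m` in the sum, by a generalized eigenvector for `c`, and `v -
m` is then one too. -/
theorem mem_iSup_maxGenEigenspace_of_sub_smul [FiniteDimensional ℝ V] (h : End ℝ V) (c : ℝ) {v : V}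
    (hv : (h - c • 1) v ∈ ⨆ μ, h.maxGenEigenspace μ) : v ∈ ⨆ μ, h.maxGenEigenspace μ := by
  have key : ∀ w ∈ ⨆ μ, h.maxGenEigenspace μ, ∃ m ∈ ⨆ μ, h.maxGenEigenspace μ,
      w - (h - c • 1) m ∈ h.maxGenEigenspace c := by
    intro w hw
    induction hw using Submodule.iSup_induction' with
    | zero => exact ⟨0, by simp, by simp⟩
    | add x y _ _ hx hy =>
      obtain ⟨a, ha, ha'⟩ := hx
      obtain ⟨b, hb, hb'⟩ := hy
      refine ⟨a + b, add_mem ha hb, ?_⟩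
      convert add_mem ha' hb' using 1
      rw [map_add]; abel
    | mem μ x hx =>
      by_cases hμ : μ = c
      · exact ⟨0, by simp, by simpa [← hμ] using hx⟩
      have hmaps : ∀ y ∈ h.maxGenEigenspace μ, (h - c • 1) y ∈ h.maxGenEigenspace μ := by
        intro y hy
        refine End.mapsTo_maxGenEigenspace_of_comm (f := h) (g := h - c • 1) ?_ μ hy
        exact (Commute.refl h).sub_right ((Commute.one_right h).smul_right c)
      have hinj : Function.Injective ((h - c • 1).restrict hmaps) := by
        rw [injective_iff_map_eq_zero]
        intro y hy
        have hy' : (h - c • 1) (y : V) = 0 := congrArg Subtype.val hy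
        have h1 : (y : V) ∈ h.maxGenEigenspace c := by
          rw [End.mem_maxGenEigenspace]
          exact ⟨1, by simpa using hy'⟩
        have := (h.disjoint_genEigenspace hμ ⊤ ⊤).le_bot ⟨y.2, h1⟩
        exact Subtype.ext this
      obtain ⟨y, hy⟩ := LinearMap.injective_iff_surjective.mp hinj ⟨x, hx⟩
      have hy' : (h - c • 1) (y : V) = x := congrArg Subtype.val hy
      exact ⟨y, Submodule.mem_iSup_of_mem μ y.2, by simp [hy']⟩
  obtain ⟨m, hm, hm'⟩ := key _ hv
  rw [← map_sub, End.mem_maxGenEigenspace] at hm'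
  obtain ⟨k, hk⟩ := hm'
  have : v - m ∈ h.maxGenEigenspace c := by
    rw [End.mem_maxGenEigenspace]
    exact ⟨k + 1, by rw [pow_succ, End.mul_apply, hk]⟩
  rw [← sub_add_cancel v m]
  exact add_mem (Submodule.mem_iSup_of_mem c this) hm

theorem mem_iSup_maxGenEigenspace_of_prod [FiniteDimensional ℝ V] (h : End ℝ V) (N : ℕ) (c : ℕ → ℝ)
    {v : V} (hv : (∏ j ∈ Finset.range N, (Polynomial.X - Polynomial.C (c j))).aeval h v ∈
      ⨆ μ, h.maxGenEigenspace μ) : v ∈ ⨆ μ, h.maxGenEigenspace μ := by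
  induction N with
  | zero => simpa using hv
  | succ N ih =>
    rw [Finset.prod_range_succ, mul_comm, map_mul, End.mul_apply] at hv
    rw [aeval_X_sub_C] at hv
    exact ih (mem_iSup_maxGenEigenspace_of_sub_smul h (c N) hv)

namespace SlTriple

variable {h e f : End ℝ V}

theorem aeval_prod_mul_e_pow (t : SlTriple h e f) (N k : ℕ) :
    (∏ j ∈ Finset.range N, (Polynomial.X - Polynomial.C (j : ℝ))).aeval h * e ^ k =
      e ^ k * (∏ j ∈ Finset.range N, (Polynomial.X - Polynomial.C (j - 2 * k : ℝ))).aeval h := by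
  induction N with
  | zero => simp
  | succ N ih =>
    have := t.h_mul_e_pow (N - 2 * k) k
    rw [sub_add_cancel] at this
    rw [Finset.prod_range_succ, Finset.prod_range_succ, map_mul, map_mul, ← mul_assoc, ← ih,
      mul_assoc, mul_assoc, aeval_X_sub_C, aeval_X_sub_C, this]

/-- Induction on `k` with `eᵏ v = 0`: the polynomial in `h` that kills `ker e` moves past `eᵏ` with
its roots shifted by `2k`, and its linear factors are then peeled off. -/
theorem iSup_maxGenEigenspace_eq_top [FiniteDimensional ℝ V] (t : SlTriple h e f) :
    ⨆ μ, h.maxGenEigenspace μ = ⊤ := by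
  obtain ⟨N, hN⟩ := t.exists_prod_apply_eq_zero
  have key : ∀ (k : ℕ) (v : V), (e ^ k) v = 0 → v ∈ ⨆ μ, h.maxGenEigenspace μ := by
    intro k
    induction k with
    | zero => intro v hv; simp at hv; simp [hv]
    | succ k ih =>
      intro v hv
      rw [pow_succ', End.mul_apply] at hv
      have h1 := hN _ hv
      rw [← End.mul_apply, t.aeval_prod_mul_e_pow, End.mul_apply] at h1
      exact mem_iSup_maxGenEigenspace_of_prod h N _ (ih _ h1)
  obtain ⟨K, hK⟩ := t.e_isNilpotent
  exact eq_top_iff.mpr fun v _ ↦ key K v (by simp [hK])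

/-- With `h = ef - fe` and `e² = 0`, both `he` and `-eh` equal `efe`, while their sum is `2e`. -/
theorem efe_of_sq_eq_zero (t : SlTriple h e f) (he : e * e = 0) : e * f * e = e := by
  have h1 : h * e = e * f * e := by rw [← t.ef, sub_mul, mul_assoc f, he, mul_zero, sub_zero]
  have h2 : e * h = -(e * f * e) := by
    rw [← t.ef, mul_sub, ← mul_assoc, he, zero_mul, zero_sub, mul_assoc]
  have h3 := t.he
  rw [h1, h2, sub_neg_eq_add, ← two_smul ℝ] at h3
  exact smul_right_injective _ (two_ne_zero' ℝ) h3

theorem h_mul_e_of_sq_eq_zero (t : SlTriple h e f) (he : e * e = 0) : h * e = e := by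
  rw [← t.ef, sub_mul, mul_assoc f, he, mul_zero, sub_zero, t.efe_of_sq_eq_zero he]

/-- From `he = e` and `hf = -f`, left multiplication by `h²` fixes `ef - fe = h`. -/
theorem h_cubed_of_sq_eq_zero (t : SlTriple h e f) (he : e * e = 0) (hf : f * f = 0) :
    h * h * h = h := by
  have h1 := t.h_mul_e_of_sq_eq_zero he
  have h2 := t.symm.h_mul_e_of_sq_eq_zero hf
  rw [neg_mul, neg_eq_iff_eq_neg] at h2
  conv_lhs => rw [← t.ef]
  rw [t.ef]
  conv_lhs => enter [2]; rw [← t.ef]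
  rw [mul_sub, ← mul_assoc, ← mul_assoc, mul_assoc h h e, h1, h1, mul_assoc h h f, h2, mul_neg, h2,
    neg_neg, t.ef]

theorem e_mem_maxGenEigenspace (t : SlTriple h e f) {v : V} {c : ℝ}
    (hv : v ∈ h.maxGenEigenspace c) : e v ∈ h.maxGenEigenspace (c + 2) := by
  rw [End.mem_maxGenEigenspace] at hv ⊢
  obtain ⟨k, hk⟩ := hv
  refine ⟨k, ?_⟩
  have : SemiconjBy e (h - c • 1) (h - (c + 2) • 1) := (t.h_mul_e c).symm
  rw [← End.mul_apply, ← (this.pow_right k).eq, End.mul_apply, hk, map_zero]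

/-- Two applications of `e` raise a generalized eigenvalue by `4`, which leaves the interval `[-1,
1]`. -/
theorem e_sq_eq_zero [FiniteDimensional ℝ V] (t : SlTriple h e f)
    (hev : ∀ (c : ℝ) (v : V), v ≠ 0 → h v = c • v → |c| ≤ 1) : e * e = 0 := by
  have hbot : ∀ c : ℝ, 1 < |c| → ∀ v ∈ h.maxGenEigenspace c, v = 0 := by
    intro c hc v hv
    by_contra hv0
    have : h.HasEigenvalue c := by
      by_contra hne
      have h1 : h.maxGenEigenspace c = ⊥ := by
        by_contra h2
        exact hne (End.HasUnifEigenvalue.lt zero_lt_one h2)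
      rw [h1] at hv
      exact hv0 hv
    obtain ⟨w, hw⟩ := this.exists_hasEigenvector
    exact absurd (hev c w hw.2 hw.apply_eq_smul) (not_le.mpr hc)
  have htop : (⊤ : Submodule ℝ V) ≤ LinearMap.ker (e * e) := by
    rw [← t.iSup_maxGenEigenspace_eq_top, iSup_le_iff]
    intro c v hv
    rw [LinearMap.mem_ker, End.mul_apply]
    by_cases hc : |c| ≤ 1
    · refine hbot (c + 2 + 2) ?_ _ (t.e_mem_maxGenEigenspace (t.e_mem_maxGenEigenspace hv))
      rw [abs_le] at hc
      rw [lt_abs]; left; linarith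
    · rw [hbot c (not_le.mp hc) v hv]; simp
  ext v
  exact htop (Submodule.mem_top (x := v))

theorem h_cubed [FiniteDimensional ℝ V] (t : SlTriple h e f)
    (hev : ∀ (c : ℝ) (v : V), v ≠ 0 → h v = c • v → |c| ≤ 1) : h * h * h = h := by
  refine t.h_cubed_of_sq_eq_zero (t.e_sq_eq_zero hev) (t.symm.e_sq_eq_zero fun c v hv hc ↦ ?_)
  rw [← abs_neg]
  refine hev (-c) v hv ?_
  rw [neg_smul, ← hc]; simp

end SlTriple

end SlTriple

/-! ### Joint eigenvectors of commuting endomorphisms. -/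

section JointEigenvectors

variable {V ι : Type*} [AddCommGroup V] [Module ℝ V]

/-- Operators are treated one at a time: `w` is replaced by the last nonzero `(D i - χ i)ᵐ w`, and
commutativity preserves what was already achieved. -/
theorem exists_joint_eigenvector [Fintype ι] (D : ι → End ℝ V) (hD : ∀ i j, Commute (D i) (D j)) (χ : ι → ℝ)
    {v : V} (hv0 : v ≠ 0) (hv : ∀ i, v ∈ (D i).maxGenEigenspace (χ i)) :
    ∃ w : V, w ≠ 0 ∧ ∀ i, D i w = χ i • w := by
  classical
  suffices ∀ s : Finset ι, ∃ w : V, w ≠ 0 ∧ (∀ i, w ∈ (D i).maxGenEigenspace (χ i)) ∧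
      ∀ i ∈ s, D i w = χ i • w by
    obtain ⟨w, h0, -, hw⟩ := this Finset.univ
    exact ⟨w, h0, fun i ↦ hw i (Finset.mem_univ i)⟩
  intro s
  induction s using Finset.induction_on with
  | empty => exact ⟨v, hv0, hv, by simp⟩
  | insert i s _ ih =>
    obtain ⟨w, h0, hg, hw⟩ := ih
    have hex := (End.mem_maxGenEigenspace (D i) (χ i) w).mp (hg i)
    obtain ⟨m, hm⟩ : ∃ m, Nat.find hex = m + 1 := by
      refine Nat.exists_eq_succ_of_ne_zero fun hz ↦ h0 ?_
      simpa [hz] using Nat.find_spec hex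
    have hcomm : ∀ j, Commute (D j) ((D i - χ i • 1) ^ m) := fun j ↦
      ((hD j i).sub_right ((Commute.one_right _).smul_right _)).pow_right m
    refine ⟨((D i - χ i • 1) ^ m) w, Nat.find_min hex (by lia), fun j ↦ ?_, fun j hj ↦ ?_⟩
    · exact End.mapsTo_maxGenEigenspace_of_comm (hcomm j) _ (hg j)
    · obtain rfl | hj := Finset.mem_insert.mp hj
      · have := Nat.find_spec hex
        rw [hm, pow_succ', End.mul_apply] at this
        simpa [sub_eq_zero] using this
      · rw [← End.mul_apply, (hcomm j).eq, End.mul_apply, hw j hj, map_smul]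

theorem card_le_finrank_of_joint_eigenvectors [FiniteDimensional ℝ V] (D : ι → End ℝ V) (hD : ∀ i j, Commute (D i) (D j))
    {κ : Type*} [Fintype κ] (χ : κ → ι → ℝ) (hχ : Function.Injective χ)
    (h : ∀ k, ∃ v : V, v ≠ 0 ∧ ∀ i, D i v = χ k i • v) : Fintype.card κ ≤ finrank ℝ V := by
  choose v hv0 hv using h
  have hind := (End.independent_iInf_maxGenEigenspace_of_forall_mapsTo D
    fun i j φ ↦ End.mapsTo_maxGenEigenspace_of_comm (hD j i) φ).comp hχ
  refine LinearIndependent.fintype_card_le_finrank (b := v)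
    (hind.linearIndependent _ (fun k ↦ ?_) hv0)
  rw [Function.comp_apply, Submodule.mem_iInf]
  intro i
  rw [End.mem_maxGenEigenspace]
  exact ⟨1, by simp [hv k i]⟩

end JointEigenvectors

end SplitInclusion

/-! ### Combinatorics of weights of type `C`. -/

namespace SplitInclusion

/-- A set of integral weights that contains, with `χ` and a root `α` of type `C` with positive
pairing `⟨χ, α^∨⟩`, also `χ - α`. -/
structure RootClosed {n : ℕ} (Λ : Set (Fin n → ℤ)) : Prop where
  short : ∀ χ ∈ Λ, ∀ i j, i ≠ j → ∀ s t : ℤˣ, 0 < s * χ i + t * χ j →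
    χ - Pi.single i (s : ℤ) - Pi.single j (t : ℤ) ∈ Λ
  long : ∀ χ ∈ Λ, ∀ i, ∀ s : ℤˣ, 0 < s * χ i → χ - Pi.single i (2 * s : ℤ) ∈ Λ

namespace RootClosed

variable {n : ℕ} {Λ : Set (Fin n → ℤ)}

theorem exists_unit_mul_eq_abs (a : ℤ) : ∃ s : ℤˣ, (s : ℤ) * a = |a| := by
  rcases abs_choice a with h | h
  · exact ⟨1, by simp [h]⟩
  · exact ⟨-1, by simp [h]⟩

theorem exists_unit_eq {a : ℤ} (h0 : a ≠ 0) (h1 : |a| ≤ 1) : ∃ s : ℤˣ, a = s := by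
  rw [abs_le] at h1
  obtain h | h : a = 1 ∨ a = -1 := by lia
  · exact ⟨1, by simp [h]⟩
  · exact ⟨-1, by simp [h]⟩

theorem sum_sq_sub_single (χ : Fin n → ℤ) (i : Fin n) (s : ℤ) :
    ∑ l, (χ - Pi.single i s : Fin n → ℤ) l ^ 2 = ∑ l, χ l ^ 2 - 2 * s * χ i + s ^ 2 := by
  have : ∀ l, (χ - Pi.single i s : Fin n → ℤ) l ^ 2 =
      χ l ^ 2 - (if l = i then 2 * s * χ i - s ^ 2 else 0) := by
    intro l
    by_cases h : l = i
    · subst h; simp; ring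
    · simp [h]
  simp only [this, Finset.sum_sub_distrib, Finset.sum_ite_eq', Finset.mem_univ, if_true]
  ring

/-- A weight outside `{0, ± eᵢ}` leads to a weight `± eᵢ ± eⱼ` or `± eᵢ ± eⱼ ± eₖ`. -/
theorem exists_pair_or_triple (hΛ : RootClosed Λ) (hn : 3 ≤ n) {χ : Fin n → ℤ} (hχ : χ ∈ Λ)
    (hbig : (∃ i, 2 ≤ |χ i|) ∨ ∃ i j, i ≠ j ∧ χ i ≠ 0 ∧ χ j ≠ 0) :
    (∃ i j, i ≠ j ∧ ∃ s t : ℤˣ, Pi.single i (s : ℤ) + Pi.single j (t : ℤ) ∈ Λ) ∨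
    ∃ i j k, i ≠ j ∧ i ≠ k ∧ j ≠ k ∧ ∃ s t r : ℤˣ,
      Pi.single i (s : ℤ) + Pi.single j (t : ℤ) + Pi.single k (r : ℤ) ∈ Λ := by
  have hpos : ∀ χ : Fin n → ℤ, 0 ≤ ∑ l, χ l ^ 2 := fun χ ↦ Finset.sum_nonneg fun l _ ↦ sq_nonneg _
  generalize hN : (∑ l, χ l ^ 2).toNat = N
  -- Descent on the squared length, which must drop while the weight stays outside `{0, ± eᵢ}`.
  induction N using Nat.strong_induction_on generalizing χ with
  | _ N ih =>
  have step : ∀ χ' ∈ Λ, ((∃ i, 2 ≤ |χ' i|) ∨ ∃ i j, i ≠ j ∧ χ' i ≠ 0 ∧ χ' j ≠ 0) →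
      ∑ l, χ' l ^ 2 < ∑ l, χ l ^ 2 → _ := fun χ' h1 h2 h3 ↦
    ih (∑ l, χ' l ^ 2).toNat (by have := hpos χ'; lia) h1 h2 rfl
  have hsq : ∀ s : ℤˣ, (s : ℤ) ^ 2 = 1 := fun s ↦ by rcases Int.units_eq_one_or s with rfl | rfl <;> rfl
  by_cases h2 : ∃ i, 2 ≤ |χ i|
  · obtain ⟨i, hi⟩ := h2
    obtain ⟨s, hs⟩ := exists_unit_mul_eq_abs (χ i)
    -- With a zero coordinate `k`, subtracting `s eᵢ + eₖ` makes it nonzero and keeps coordinate `i`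
    -- nonzero; otherwise `2s eᵢ` is subtracted, and two further nonzero coordinates survive because
    -- `n ≥ 3`.
    by_cases h0 : ∃ k, χ k = 0
    · obtain ⟨k, hk⟩ := h0
      have hik : i ≠ k := by rintro rfl; simp [hk] at hi
      refine step _ (hΛ.short χ hχ i k hik s 1 (by rw [hs, hk]; lia)) (Or.inr ⟨i, k, hik, ?_, ?_⟩) ?_
      · have : (χ i - s : ℤ) ≠ 0 := by
          intro h
          rw [sub_eq_zero.mp h] at hs hi
          rcases Int.units_eq_one_or s with rfl | rfl <;> norm_num at hi
        simpa [hik] using this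
      · simp [hik.symm, hk]
      · rw [sum_sq_sub_single, sum_sq_sub_single, hsq]
        simp only [Pi.sub_apply, Pi.single_eq_of_ne hik.symm, hk, Units.val_one]
        have := hsq s
        nlinarith
    · push Not at h0
      obtain ⟨j, k, hj, hk, hjk⟩ : ∃ j k, j ≠ i ∧ k ≠ i ∧ j ≠ k := by
        have h3 : 2 < Fintype.card (Fin n) := by rw [Fintype.card_fin]; lia
        obtain ⟨a, b, c, hab, hac, hbc⟩ := Fintype.two_lt_card_iff.mp h3
        by_cases ha : a = i
        · exact ⟨b, c, by grind, by grind, hbc⟩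
        · by_cases hb : b = i
          · exact ⟨a, c, ha, by grind, hac⟩
          · exact ⟨a, b, ha, hb, hab⟩
      refine step _ (hΛ.long χ hχ i s (by rw [hs]; lia)) (Or.inr ⟨j, k, hjk, ?_, ?_⟩) ?_
      · simpa [hj] using h0 j
      · simpa [hk] using h0 k
      · rw [sum_sq_sub_single]
        have := hsq s
        nlinarith
  · have hle : ∀ l, |χ l| ≤ 1 := fun l ↦ by
      by_contra h; exact h2 ⟨l, by lia⟩
    obtain ⟨i, j, hij, hi, hj⟩ := hbig.resolve_left h2
    obtain ⟨s, hs⟩ := exists_unit_eq hi (hle i)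
    obtain ⟨t, ht⟩ := exists_unit_eq hj (hle j)
    -- All coordinates are now `0` or `± 1`. With at least four nonzero ones, two can be cancelled
    -- and two remain; otherwise the weight already has the required form.
    by_cases h4 : ∃ a b, a ≠ b ∧ a ≠ i ∧ a ≠ j ∧ b ≠ i ∧ b ≠ j ∧ χ a ≠ 0 ∧ χ b ≠ 0
    · obtain ⟨a, b, hab, hai, haj, hbi, hbj, ha, hb⟩ := h4
      have hs' := hsq s
      have ht' := hsq t
      refine step _ (hΛ.short χ hχ i j hij s t (by rw [hs, ht]; nlinarith))
        (Or.inr ⟨a, b, hab, ?_, ?_⟩) ?_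
      · simpa [hai, haj] using ha
      · simpa [hbi, hbj] using hb
      · rw [sum_sq_sub_single, sum_sq_sub_single]
        simp only [Pi.sub_apply, Pi.single_eq_of_ne hij.symm, hs, ht]
        nlinarith
    · by_cases h3 : ∃ k, k ≠ i ∧ k ≠ j ∧ χ k ≠ 0
      · obtain ⟨k, hki, hkj, hk⟩ := h3
        obtain ⟨r, hr⟩ := exists_unit_eq hk (hle k)
        refine Or.inr ⟨i, j, k, hij, hki.symm, hkj.symm, s, t, r, ?_⟩
        convert hχ using 1
        ext l
        simp only [Pi.add_apply, Pi.single_apply]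
        grind
      · refine Or.inl ⟨i, j, hij, s, t, ?_⟩
        convert hχ using 1
        ext l
        simp only [Pi.add_apply, Pi.single_apply]
        grind

/-- The root subtracted is `s eᵢ - s' eₖ`, or `2s eᵢ` when a sign is changed in place. -/
theorem move (hΛ : RootClosed Λ) {χ : Fin n → ℤ} (hχ : χ ∈ Λ) {i k : Fin n} (s s' : ℤˣ)
    (hi : χ i = s) (hk : k = i ∨ χ k = 0) :
    χ - Pi.single i (s : ℤ) + Pi.single k (s' : ℤ) ∈ Λ := by
  by_cases hik : k = i
  · subst hik
    obtain rfl | rfl : s' = s ∨ s' = -s := by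
      rcases Int.units_eq_one_or s with rfl | rfl <;>
        rcases Int.units_eq_one_or s' with rfl | rfl <;> simp
    · simpa using hχ
    · convert hΛ.long χ hχ k s (by rw [hi]; simp) using 1
      ext l
      simp only [Pi.add_apply, Pi.sub_apply, Pi.single_apply, Units.val_neg]
      grind
  · have := hΛ.short χ hχ i k (Ne.symm hik) s (-s') (by rw [hi, hk.resolve_left hik]; simp)
    simpa [Pi.single_neg] using this

theorem pair_mem (hΛ : RootClosed Λ) {i j : Fin n} (hij : i ≠ j) {s t : ℤˣ}
    (h : Pi.single i (s : ℤ) + Pi.single j (t : ℤ) ∈ Λ) (k l : Fin n) (hkl : k ≠ l) (s' t' : ℤˣ) :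
    Pi.single k (s' : ℤ) + Pi.single l (t' : ℤ) ∈ Λ := by
  -- Each use moves the first summand and exchanges the two, so two uses move both. If the target
  -- `k` is already occupied by the second summand, the summands are exchanged beforehand.
  have key : ∀ {i j : Fin n} (_ : i ≠ j) {s t : ℤˣ}
      (_ : Pi.single i (s : ℤ) + Pi.single j (t : ℤ) ∈ Λ) (k : Fin n) (_ : k ≠ j) (s' : ℤˣ),
      Pi.single j (t : ℤ) + Pi.single k (s' : ℤ) ∈ Λ := by
    intro i j hij s t h k hk s'
    have := hΛ.move h (i := i) (k := k) s s' (by simp [hij])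
      (by by_cases hki : k = i; exacts [Or.inl hki, Or.inr (by simp [hki, hk])])
    convert this using 1
    abel
  by_cases hkj : k = j
  · subst hkj
    rw [add_comm] at h
    have h1 := key hij.symm h k hij.symm s'
    have h2 := key hij h1 l hkl.symm t'
    exact h2
  · have h1 := key hij h k hkj s'
    exact key (Ne.symm hkj) h1 l hkl.symm t'

theorem not_pair (hΛ : RootClosed Λ) (hn : 3 ≤ n)
    (hcard : ∀ (κ : Type) [Fintype κ] (F : κ → Fin n → ℤ), Function.Injective F → (∀ k, F k ∈ Λ) →
      Fintype.card κ ≤ 4 * n) {i j : Fin n} (hij : i ≠ j) {s t : ℤˣ} :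
    Pi.single i (s : ℤ) + Pi.single j (t : ℤ) ∉ Λ := by
  intro h
  have h0 : (0 : Fin n → ℤ) ∈ Λ := by
    have := hΛ.short _ h i j hij s t (by simp [hij, hij.symm])
    convert this using 1
    abel
  have hall := hΛ.pair_mem hij h
  have h3 : 2 < Fintype.card (Fin n) := by rw [Fintype.card_fin]; lia
  obtain ⟨a, b, c, hab, hac, hbc⟩ := Fintype.two_lt_card_iff.mp h3
  -- There are `4n + 1` distinct weights: `0`, the `4(n - 1)` weights `± eₐ ± eₗ` with `l ≠ a`, and
  -- the four `± e_b ± e_c` in the unused slot `l = a`.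
  let F : Option (Fin n × ℤˣ × ℤˣ) → Fin n → ℤ := fun o ↦ o.elim 0 fun p ↦
    if p.1 = a then Pi.single b (p.2.1 : ℤ) + Pi.single c (p.2.2 : ℤ)
    else Pi.single a (p.2.1 : ℤ) + Pi.single p.1 (p.2.2 : ℤ)
  have hu : ∀ u : ℤˣ, (u : ℤ) ≠ 0 := fun u ↦ u.ne_zero
  have hF : Function.Injective F := by
    rintro (_ | ⟨l, s, t⟩) (_ | ⟨l', s', t'⟩) hFF
    · rfl
    · exfalso
      have h1 := congrFun hFF a
      have h2 := congrFun hFF b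
      simp only [F, Option.elim, Pi.zero_apply] at h1 h2
      have := hu s'; have := hu t'
      by_cases hl : l' = a <;>
        simp only [hl, if_true, if_false, Pi.add_apply, Pi.single_apply] at h1 h2 <;> grind
    · exfalso
      have h1 := congrFun hFF a
      have h2 := congrFun hFF b
      simp only [F, Option.elim, Pi.zero_apply] at h1 h2
      have := hu s; have := hu t
      by_cases hl : l = a <;>
        simp only [hl, if_true, if_false, Pi.add_apply, Pi.single_apply] at h1 h2 <;> grind
    · have h1 := congrFun hFF a
      have h2 := congrFun hFF b
      have h3 := congrFun hFF c
      have h4 := congrFun hFF l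
      simp only [F, Option.elim] at h1 h2 h3 h4
      have hs : ∀ u v : ℤˣ, (u : ℤ) = v → u = v := fun u v ↦ Units.ext
      have := hu s; have := hu s'; have := hu t; have := hu t'
      by_cases hl : l = a <;> by_cases hl' : l' = a <;>
        simp only [hl, hl', if_true, if_false, Pi.add_apply, Pi.single_apply] at h1 h2 h3 h4 <;> grind
  have := hcard _ F hF (by
    rintro (_ | ⟨l, s, t⟩)
    · exact h0
    · simp only [F, Option.elim]
      split_ifs with hl
      · exact hall b c hbc s t
      · exact hall a l (Ne.symm hl) s t)
  simp [Fintype.card_units_int] at this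
  lia

theorem not_triple (hΛ : RootClosed Λ) (hn : 3 ≤ n)
    (hcard : ∀ (κ : Type) [Fintype κ] (F : κ → Fin n → ℤ), Function.Injective F → (∀ k, F k ∈ Λ) →
      Fintype.card κ ≤ 4 * n) {a b c : Fin n} (hab : a ≠ b) (hac : a ≠ c) (hbc : b ≠ c)
    {s t r : ℤˣ} :
    Pi.single a (s : ℤ) + Pi.single b (t : ℤ) + Pi.single c (r : ℤ) ∉ Λ := by
  intro h
  have h1 : ∀ (l : Fin n) (s' : ℤˣ), Pi.single l (s' : ℤ) ∈ Λ := by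
    intro l s'
    have h2 := hΛ.short _ h a b hab s t (by simp [hab, hab.symm, hac, hbc])
    have h3 : Pi.single c (r : ℤ) ∈ Λ := by
      convert h2 using 1
      abel
    have := hΛ.move h3 (i := c) (k := l) r s' (by simp)
      (by by_cases hl : l = c; exacts [Or.inl hl, Or.inr (by simp [hl])])
    simpa using this
  have h3 : ∀ l, l ≠ a → l ≠ b → ∀ s' t' r' : ℤˣ,
      Pi.single a (s' : ℤ) + Pi.single b (t' : ℤ) + Pi.single l (r' : ℤ) ∈ Λ := by
    intro l hla hlb s' t' r'
    have e1 := hΛ.move h (i := a) (k := a) s s' (by simp [hab, hac]) (Or.inl rfl)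
    have e2 := hΛ.move e1 (i := b) (k := b) t t' (by simp [hab.symm, hbc]) (Or.inl rfl)
    have e3 := hΛ.move e2 (i := c) (k := l) r r' (by simp [hac.symm, hbc.symm])
      (by by_cases hl : l = c; exacts [Or.inl hl, Or.inr (by simp [hl, hla, hlb])])
    convert e3 using 1
    abel
  -- The `2n` weights `± eₗ` and the `8(n - 2)` weights `± eₐ ± e_b ± eₗ` number `10n - 16`, which
  -- exceeds `4n` for `n ≥ 3`.
  let F : (Fin n × ℤˣ) ⊕ ({l : Fin n // l ∉ ({a, b} : Finset (Fin n))} × ℤˣ × ℤˣ × ℤˣ) →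
      Fin n → ℤ :=
    Sum.elim (fun p ↦ Pi.single p.1 (p.2 : ℤ)) fun p ↦
      Pi.single a (p.2.1 : ℤ) + Pi.single b (p.2.2.1 : ℤ) + Pi.single p.1.1 (p.2.2.2 : ℤ)
  have hs : ∀ u v : ℤˣ, (u : ℤ) = v → u = v := fun u v ↦ Units.ext
  have hu : ∀ u : ℤˣ, (u : ℤ) ≠ 0 := fun u ↦ u.ne_zero
  have hF : Function.Injective F := by
    rintro (⟨l, s⟩ | ⟨⟨l, hl⟩, s, t, r⟩) (⟨l', s'⟩ | ⟨⟨l', hl'⟩, s', t', r'⟩) hFF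
    · have h4 := congrFun hFF l
      simp only [F, Sum.elim_inl, Pi.single_apply] at h4
      have := hu s
      grind
    · exfalso
      have e1 := congrFun hFF a
      have e2 := congrFun hFF b
      simp only [F, Sum.elim_inl, Sum.elim_inr, Pi.single_apply, Pi.add_apply, Finset.mem_insert,
        Finset.mem_singleton, not_or] at e1 e2 hl'
      have := hu s; have := hu s'; have := hu t'
      grind
    · exfalso
      have e1 := congrFun hFF a
      have e2 := congrFun hFF b
      simp only [F, Sum.elim_inl, Sum.elim_inr, Pi.single_apply, Pi.add_apply, Finset.mem_insert,
        Finset.mem_singleton, not_or] at e1 e2 hl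
      have := hu s; have := hu s'; have := hu t
      grind
    · have e1 := congrFun hFF a
      have e2 := congrFun hFF b
      have e3 := congrFun hFF l
      simp only [F, Sum.elim_inr, Pi.single_apply, Pi.add_apply, Finset.mem_insert,
        Finset.mem_singleton, not_or] at e1 e2 e3 hl hl'
      have := hu r
      have hll : l = l' := by grind
      subst hll
      have := hs s s'; have := hs t t'; have := hs r r'
      grind
  have := hcard _ F hF (by
    rintro (⟨l, s⟩ | ⟨⟨l, hl⟩, s, t, r⟩)
    · exact h1 l s
    · simp only [Finset.mem_insert, Finset.mem_singleton, not_or] at hl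
      exact h3 l hl.1 hl.2 s t r)
  have hc : Fintype.card {l : Fin n // l ∉ ({a, b} : Finset (Fin n))} = n - 2 := by
    rw [Fintype.card_subtype_compl, Fintype.card_coe, Finset.card_pair hab, Fintype.card_fin]
  rw [Fintype.card_sum, Fintype.card_prod, Fintype.card_prod, Fintype.card_prod, Fintype.card_prod,
    hc, Fintype.card_units_int, Fintype.card_fin] at this
  lia

/-- If there are at most `4n` weights, they are among `0` and `± eᵢ`. -/
theorem eq_zero_or_single (hΛ : RootClosed Λ) (hn : 3 ≤ n)
    (hcard : ∀ (κ : Type) [Fintype κ] (F : κ → Fin n → ℤ), Function.Injective F → (∀ k, F k ∈ Λ) →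
      Fintype.card κ ≤ 4 * n) {χ : Fin n → ℤ} (hχ : χ ∈ Λ) :
    (∀ i, |χ i| ≤ 1) ∧ ∀ i j, i ≠ j → χ i * χ j = 0 := by
  by_contra hcon
  have hbig : (∃ i, 2 ≤ |χ i|) ∨ ∃ i j, i ≠ j ∧ χ i ≠ 0 ∧ χ j ≠ 0 := by
    rw [not_and_or] at hcon
    push Not at hcon
    refine hcon.imp (fun ⟨i, hi⟩ ↦ ⟨i, hi⟩) fun ⟨i, j, hij, h⟩ ↦ ⟨i, j, hij, mul_ne_zero_iff.mp h⟩
  rcases hΛ.exists_pair_or_triple hn hχ hbig with ⟨i, j, hij, s, t, h⟩ | ⟨i, j, k, h1, h2, h3, s, t, r, h⟩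
  · exact hΛ.not_pair hn hcard hij h
  · exact hΛ.not_triple hn hcard h1 h2 h3 h

end RootClosed

end SplitInclusion

/-! ### Root vectors of `𝔰𝔭(n, ℝ)` and the weights of its small representations. -/

namespace SplitInclusion

open Module

/-- The commutation relations between the root vectors of `𝔰𝔭(n, ℝ)`: `a i j` stands for
`[Eᵢⱼ, 0; 0, -Eⱼᵢ]`, `b i j` for `[0, Eᵢⱼ + Eⱼᵢ; 0, 0]` and `c i j` for `[0, 0; Eᵢⱼ + Eⱼᵢ, 0]`. -/
structure SpRelations {n : ℕ} {V : Type*} [AddCommGroup V] [Module ℝ V]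
    (a b c : Fin n → Fin n → End ℝ V) : Prop where
  b_symm : ∀ i j, b i j = b j i
  c_symm : ∀ i j, c i j = c j i
  aa : ∀ i j k l, a i j * a k l - a k l * a i j =
    (if j = k then a i l else 0) - (if l = i then a k j else 0)
  ab : ∀ i j k l, a i j * b k l - b k l * a i j =
    (if j = k then b i l else 0) + (if j = l then b i k else 0)
  ac : ∀ i j k l, a i j * c k l - c k l * a i j =
    -((if k = i then c l j else 0) + (if l = i then c k j else 0))
  bc : ∀ i j k l, b i j * c k l - c k l * b i j =
    (if j = k then a i l else 0) + (if j = l then a i k else 0) +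
      ((if i = k then a j l else 0) + (if i = l then a j k else 0))

namespace SpRelations

variable {n : ℕ} {V : Type*} [AddCommGroup V] [Module ℝ V] {a b c : Fin n → Fin n → End ℝ V}

theorem commute_diag (R : SpRelations a b c) (i j : Fin n) : Commute (a i i) (a j j) := by
  have := R.aa i i j j
  rw [commute_iff_eq, ← sub_eq_zero, this]
  by_cases h : i = j
  · subst h; simp
  · simp [h, Ne.symm h]

theorem diag_mul_a (R : SpRelations a b c) (l i j : Fin n) :
    a l l * a i j - a i j * a l l =
      (Pi.single i 1 - Pi.single j 1 : Fin n → ℝ) l • a i j := by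
  rw [R.aa, Pi.sub_apply, Pi.single_apply, Pi.single_apply, sub_smul]
  congr 1
  · split_ifs with h <;> simp [h]
  · by_cases h : l = j
    · simp [h]
    · simp [h, Ne.symm h]

theorem diag_mul_b (R : SpRelations a b c) (l i j : Fin n) :
    a l l * b i j - b i j * a l l =
      (Pi.single i 1 + Pi.single j 1 : Fin n → ℝ) l • b i j := by
  rw [R.ab, Pi.add_apply, Pi.single_apply, Pi.single_apply, add_smul]
  congr 1
  · split_ifs with h <;> simp [h]
  · split_ifs with h <;> simp [h, R.b_symm j i]

theorem diag_mul_c (R : SpRelations a b c) (l i j : Fin n) :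
    a l l * c i j - c i j * a l l =
      (-Pi.single i 1 - Pi.single j 1 : Fin n → ℝ) l • c i j := by
  rw [R.ac, Pi.sub_apply, Pi.neg_apply, Pi.single_apply, Pi.single_apply, sub_smul, neg_smul,
    neg_add, sub_eq_add_neg]
  congr 2
  · by_cases h : l = i
    · simp [h, R.c_symm j i]
    · simp [h, Ne.symm h]
  · by_cases h : l = j
    · simp [h]
    · simp [h, Ne.symm h]

theorem triple_sub (R : SpRelations a b c) {i j : Fin n} (h : i ≠ j) :
    SlTriple (a i i - a j j) (a i j) (a j i) where
  ef := by simpa using R.aa i j j i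
  he := by
    have h1 := R.diag_mul_a i i j
    have h2 := R.diag_mul_a j i j
    simp only [Pi.sub_apply, Pi.single_eq_same, Pi.single_eq_of_ne h, Pi.single_eq_of_ne h.symm]
      at h1 h2
    rw [sub_mul, mul_sub, sub_sub_sub_comm, h1, h2]
    module
  hf := by
    have h1 := R.diag_mul_a i j i
    have h2 := R.diag_mul_a j j i
    simp only [Pi.sub_apply, Pi.single_eq_same, Pi.single_eq_of_ne h, Pi.single_eq_of_ne h.symm]
      at h1 h2
    rw [sub_mul, mul_sub, sub_sub_sub_comm, h1, h2]
    module

theorem triple_add (R : SpRelations a b c) {i j : Fin n} (h : i ≠ j) :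
    SlTriple (a i i + a j j) (b i j) (c i j) where
  ef := by simpa [h, h.symm] using R.bc i j i j
  he := by
    have h1 := R.diag_mul_b i i j
    have h2 := R.diag_mul_b j i j
    simp only [Pi.add_apply, Pi.single_eq_same, Pi.single_eq_of_ne h, Pi.single_eq_of_ne h.symm]
      at h1 h2
    rw [add_mul, mul_add, add_sub_add_comm, h1, h2]
    module
  hf := by
    have h1 := R.diag_mul_c i i j
    have h2 := R.diag_mul_c j i j
    simp only [Pi.sub_apply, Pi.neg_apply, Pi.single_eq_same, Pi.single_eq_of_ne h,
      Pi.single_eq_of_ne h.symm] at h1 h2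
    rw [add_mul, mul_add, add_sub_add_comm, h1, h2]
    module

/-- The halves compensate for `Eᵢᵢ + Eᵢᵢ = 2Eᵢᵢ` in `b i i` and `c i i`. -/
theorem triple_diag (R : SpRelations a b c) (i : Fin n) :
    SlTriple (a i i) ((1 / 2 : ℝ) • b i i) ((1 / 2 : ℝ) • c i i) where
  ef := by
    have h1 := R.bc i i i i
    simp only [if_true] at h1
    simp only [smul_mul_smul_comm, ← smul_sub, h1]
    module
  he := by
    have h1 := R.ab i i i i
    simp only [if_true] at h1
    simp only [smul_mul_assoc, mul_smul_comm, ← smul_sub, h1]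
    module
  hf := by
    have h1 := R.ac i i i i
    simp only [if_true] at h1
    simp only [smul_mul_assoc, mul_smul_comm, ← smul_sub, h1]
    module

/-- `v` is a vector of weight `χ` (possibly zero). -/
def IsWeight (a : Fin n → Fin n → End ℝ V) (χ : Fin n → ℝ) (v : V) : Prop :=
  ∀ i, a i i v = χ i • v

theorem isWeight_a (R : SpRelations a b c) {χ : Fin n → ℝ} {v : V} (hv : IsWeight a χ v)
    (i j : Fin n) : IsWeight a (χ + (Pi.single i 1 - Pi.single j 1)) (a i j v) := by
  intro l
  have := congrArg (· v) (R.diag_mul_a l i j)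
  simp only [LinearMap.sub_apply, End.mul_apply, hv l, map_smul, sub_eq_iff_eq_add,
    LinearMap.smul_apply] at this
  rw [this, Pi.add_apply χ, add_smul, add_comm]

theorem isWeight_b (R : SpRelations a b c) {χ : Fin n → ℝ} {v : V} (hv : IsWeight a χ v)
    (i j : Fin n) : IsWeight a (χ + (Pi.single i 1 + Pi.single j 1)) (b i j v) := by
  intro l
  have := congrArg (· v) (R.diag_mul_b l i j)
  simp only [LinearMap.sub_apply, End.mul_apply, hv l, map_smul, sub_eq_iff_eq_add,
    LinearMap.smul_apply] at this
  rw [this, Pi.add_apply χ, add_smul, add_comm]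

theorem isWeight_c (R : SpRelations a b c) {χ : Fin n → ℝ} {v : V} (hv : IsWeight a χ v)
    (i j : Fin n) : IsWeight a (χ + (-Pi.single i 1 - Pi.single j 1)) (c i j v) := by
  intro l
  have := congrArg (· v) (R.diag_mul_c l i j)
  simp only [LinearMap.sub_apply, End.mul_apply, hv l, map_smul, sub_eq_iff_eq_add,
    LinearMap.smul_apply] at this
  rw [this, Pi.add_apply χ, add_smul, add_comm]

/-- The set of integral weights. -/
def weights (a : Fin n → Fin n → End ℝ V) : Set (Fin n → ℤ) :=
  {χ | ∃ v : V, v ≠ 0 ∧ IsWeight a (fun i ↦ (χ i : ℝ)) v}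

/-- The pairing with a root is the eigenvalue of `h` in its `𝔰𝔩₂`-triple; when it is positive, `f`
does not kill the weight vector and lowers its weight by the root. -/
theorem rootClosed_weights [FiniteDimensional ℝ V] (R : SpRelations a b c) :
    RootClosed (weights a) where
  short := by
    rintro χ ⟨v, hv0, hv⟩ i j hij s t hst
    have hst' : (0 : ℝ) < s * χ i + t * χ j := by exact_mod_cast hst
    rcases Int.units_eq_one_or s with rfl | rfl <;> rcases Int.units_eq_one_or t with rfl | rfl
    · refine ⟨c i j v, (R.triple_add hij).f_apply_ne_zero hv0 (c := χ i + χ j) ?_ ?_, ?_⟩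
      · rw [LinearMap.add_apply, hv i, hv j, add_smul]
      · simpa using hst'
      · convert R.isWeight_c hv i j using 1
        ext l; simp [Pi.single_apply]; split_ifs <;> ring
    · refine ⟨a j i v, (R.triple_sub hij).f_apply_ne_zero hv0 (c := χ i - χ j) ?_ ?_, ?_⟩
      · rw [LinearMap.sub_apply, hv i, hv j, sub_smul]
      · simpa [sub_eq_add_neg] using hst'
      · convert R.isWeight_a hv j i using 1
        ext l; simp [Pi.single_apply]; split_ifs <;> ring
    · refine ⟨a i j v, (R.triple_sub hij.symm).f_apply_ne_zero hv0 (c := χ j - χ i) ?_ ?_, ?_⟩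
      · rw [LinearMap.sub_apply, hv i, hv j, sub_smul]
      · simpa [sub_eq_add_neg, add_comm] using hst'
      · convert R.isWeight_a hv i j using 1
        ext l; simp [Pi.single_apply]; split_ifs <;> ring
    · refine ⟨b i j v, (R.triple_add hij).symm.f_apply_ne_zero hv0 (c := -(χ i + χ j)) ?_ ?_, ?_⟩
      · rw [LinearMap.neg_apply, LinearMap.add_apply, hv i, hv j, neg_smul, add_smul]
      · simp at hst'; linarith
      · convert R.isWeight_b hv i j using 1
        ext l; simp [Pi.single_apply]; split_ifs <;> ring
  long := by
    rintro χ ⟨v, hv0, hv⟩ i s hs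
    have hs' : (0 : ℝ) < s * χ i := by exact_mod_cast hs
    rcases Int.units_eq_one_or s with rfl | rfl
    · refine ⟨c i i v, fun h0 ↦ (R.triple_diag i).f_apply_ne_zero hv0 (hv i) (by simpa using hs')
        (by rw [LinearMap.smul_apply, h0, smul_zero]), ?_⟩
      convert R.isWeight_c hv i i using 1
      ext l; simp [Pi.single_apply]; split_ifs <;> ring
    · refine ⟨b i i v, fun h0 ↦ (R.triple_diag i).symm.f_apply_ne_zero hv0 (c := -χ i)
        (by rw [LinearMap.neg_apply, hv i, neg_smul]) (by simpa using hs')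
        (by rw [LinearMap.smul_apply, h0, smul_zero]), ?_⟩
      convert R.isWeight_b hv i i using 1
      ext l; simp [Pi.single_apply]; split_ifs <;> ring

theorem card_le_of_mem_weights [FiniteDimensional ℝ V] (R : SpRelations a b c) {κ : Type} [Fintype κ]
    (F : κ → Fin n → ℤ) (hF : Function.Injective F) (h : ∀ k, F k ∈ weights a) :
    Fintype.card κ ≤ finrank ℝ V := by
  refine card_le_finrank_of_joint_eigenvectors (fun i ↦ a i i) R.commute_diag
    (fun k i ↦ (F k i : ℝ)) (fun k l hkl ↦ hF ?_) h
  ext i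
  have := congrFun hkl i
  simpa using this

/-- The polynomial `t³ - t` has simple roots, so generalized eigenvectors of `D` are eigenvectors.
-/
theorem apply_eq_of_mem_maxGenEigenspace {D : End ℝ V} (hD : D * D * D = D) {k : ℝ} {v : V}
    (hv : v ∈ D.maxGenEigenspace k) : D v = k • v := by
  have key : ∀ w, (D - k • 1) ((D - k • 1) w) = 0 → (D - k • 1) w = 0 := by
    intro w hw
    set u := (D - k • 1) w with hu
    have h1 : D u = k • u := by simpa [sub_eq_zero] using hw
    have h2 : D w = k • w + u := by rw [hu]; simp
    have h3 := congrArg (· w) hD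
    have h4 := congrArg (· u) hD
    simp only [End.mul_apply, h1, h2, map_add, map_smul, smul_add, smul_smul] at h3 h4
    rw [← sub_eq_zero, ← sub_smul, smul_eq_zero] at h4
    rcases h4 with h4 | h4
    -- The coefficient is the derivative of `t³ - t` at `k`, obtained by expanding `D³ w = D w` for
    -- `D w = k w + u`, `D u = k u`; it does not vanish at a root.
    · have h5 : (3 * k ^ 2 - 1) • u = 0 := by
        have : (3 * k ^ 2 - 1) • u = -((k * (k * k) - k) • w) := by
          rw [← sub_eq_zero] at h3
          rw [← sub_eq_zero, ← h3]; module
        rw [this, h4, zero_smul, neg_zero]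
      refine (smul_eq_zero.mp h5).resolve_left fun h6 ↦ ?_
      have h7 : k * (k ^ 2 - 1) = 0 := by rw [← h4]; ring
      rcases mul_eq_zero.mp h7 with h8 | h8
      · rw [h8] at h6; norm_num at h6
      · nlinarith
    · exact h4
  rw [End.mem_maxGenEigenspace] at hv
  obtain ⟨m, hm⟩ := hv
  have : ∀ m : ℕ, ((D - k • 1) ^ (m + 1)) v = 0 → (D - k • 1) v = 0 := by
    intro m
    induction m with
    | zero => intro h; simpa using h
    | succ m ih =>
      intro h
      rw [pow_succ', pow_succ', End.mul_apply, End.mul_apply] at h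
      refine ih ?_
      rw [pow_succ', End.mul_apply]
      exact key _ h
  have h1 := this m (by rw [pow_succ', End.mul_apply, hm, map_zero])
  simpa [sub_eq_zero] using h1

/-- A nonzero joint generalized eigenspace contains a true weight vector, whose weight is integral
by `𝔰𝔩₂`-theory, so the combinatorial bound applies. -/
theorem weight_bound [FiniteDimensional ℝ V] (R : SpRelations a b c) (hn : 3 ≤ n)
    (hV : finrank ℝ V ≤ 4 * n) {χ : Fin n → ℝ} (hχ : ⨅ i, (a i i).maxGenEigenspace (χ i) ≠ ⊥) :
    (∀ i, |χ i| ≤ 1) ∧ ∀ i j, i ≠ j → χ i * χ j = 0 := by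
  obtain ⟨v, hv, hv0⟩ := Submodule.exists_mem_ne_zero_of_ne_bot hχ
  rw [Submodule.mem_iInf] at hv
  obtain ⟨w, hw0, hw⟩ := exists_joint_eigenvector (fun i ↦ a i i) R.commute_diag χ hv0 hv
  choose m hm using fun i ↦ (R.triple_diag i).exists_int_of_eigenvector hw0 (hw i)
  obtain rfl : χ = fun i ↦ (m i : ℝ) := funext hm
  have := R.rootClosed_weights.eq_zero_or_single hn
    (fun κ _ F hF h ↦ (R.card_le_of_mem_weights F hF h).trans hV) (χ := m) ⟨w, hw0, hw⟩
  refine ⟨fun i ↦ ?_, fun i j hij ↦ ?_⟩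
  · have := this.1 i
    beta_reduce; exact_mod_cast this
  · have := this.2 i j hij
    beta_reduce; exact_mod_cast this

theorem iSup_weightSpaces [FiniteDimensional ℝ V] (R : SpRelations a b c) :
    ⨆ χ : Fin n → ℝ, ⨅ i, (a i i).maxGenEigenspace (χ i) = ⊤ :=
  End.iSup_iInf_maxGenEigenspace_eq_top_of_iSup_maxGenEigenspace_eq_top_of_commute
    (fun i ↦ a i i) (fun i j _ ↦ R.commute_diag i j)
    fun i ↦ (R.triple_diag i).iSup_maxGenEigenspace_eq_top

/-- The generalized weight spaces span, and all of them lie in generalized eigenspaces of `a i i`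
for values in `[-1, 1]`. An eigenvalue outside would contradict independence, so `SlTriple.h_cubed`
applies. -/
theorem diag_cubed [FiniteDimensional ℝ V] (R : SpRelations a b c) (hn : 3 ≤ n)
    (hV : finrank ℝ V ≤ 4 * n) (i : Fin n) : a i i * a i i * a i i = a i i := by
  refine (R.triple_diag i).h_cubed fun k v hv0 hv ↦ ?_
  by_contra hk
  have hle : (⊤ : Submodule ℝ V) ≤ ⨆ (μ) (_ : μ ≠ k), (a i i).maxGenEigenspace μ := by
    rw [← R.iSup_weightSpaces, iSup_le_iff]
    intro χ
    by_cases hχ : ⨅ i, (a i i).maxGenEigenspace (χ i) = ⊥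
    · rw [hχ]; exact bot_le
    · have := (R.weight_bound hn hV hχ).1 i
      exact (iInf_le _ i).trans (le_iSup₂_of_le (χ i) (by rintro rfl; exact hk this) le_rfl)
  have hdis := (a i i).independent_maxGenEigenspace k
  rw [top_le_iff.mp hle, disjoint_top] at hdis
  have : v ∈ (a i i).maxGenEigenspace k := by
    rw [End.mem_maxGenEigenspace]
    exact ⟨1, by simp [hv]⟩
  rw [hdis] at this
  exact hv0 this

theorem diag_mul_diag [FiniteDimensional ℝ V] (R : SpRelations a b c) (hn : 3 ≤ n)
    (hV : finrank ℝ V ≤ 4 * n) {i j : Fin n} (hij : i ≠ j) : a i i * a j j = 0 := by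
  have hle : (⊤ : Submodule ℝ V) ≤ LinearMap.ker (a i i * a j j) := by
    rw [← R.iSup_weightSpaces, iSup_le_iff]
    intro χ
    by_cases hχ : ⨅ i, (a i i).maxGenEigenspace (χ i) = ⊥
    · rw [hχ]; exact bot_le
    · intro v hv
      rw [Submodule.mem_iInf] at hv
      rw [LinearMap.mem_ker, End.mul_apply,
        apply_eq_of_mem_maxGenEigenspace (R.diag_cubed hn hV j) (hv j), map_smul,
        apply_eq_of_mem_maxGenEigenspace (R.diag_cubed hn hV i) (hv i), smul_smul, mul_comm,
        (R.weight_bound hn hV hχ).2 i j hij, zero_smul]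
  ext v
  exact hle (Submodule.mem_top (x := v))

end SpRelations

end SplitInclusion

/-! ### Modules with weights `0` and `± eᵢ`: the factorization `ℝ²ⁿ ⊗ topSpace`. -/

namespace SplitInclusion

open Module

/-- The relations of `SpRelations` together with the condition that all weights are among `0` and
`± eᵢ`, that is, that the representation is a sum of copies of the trivial and the standard one. -/
structure StandardSp {n : ℕ} {V : Type*} [AddCommGroup V] [Module ℝ V]
    (a b c : Fin n → Fin n → End ℝ V) : Prop extends SpRelations a b c where
  cubed : ∀ i, a i i * a i i * a i i = a i i
  orthogonal : ∀ i j, i ≠ j → a i i * a j j = 0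

namespace StandardSp

open SpRelations

variable {n : ℕ} {V : Type*} [AddCommGroup V] [Module ℝ V] {a b c : Fin n → Fin n → End ℝ V}

/-- This criterion and the next one exclude every weight outside `{0, ± eᵢ}`: a coordinate is not
`0, ± 1`, or two are nonzero. The vanishing lemmas below apply them to the weight that a root vector
would produce. -/
theorem eq_zero_of_cube_ne (S : StandardSp a b c) {χ : Fin n → ℝ} {v : V} (hv : IsWeight a χ v)
    (k : Fin n) (hk : χ k * χ k * χ k ≠ χ k) : v = 0 := by
  have := congrArg (· v) (S.cubed k)
  simp only [End.mul_apply, hv k, map_smul, smul_smul] at this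
  rw [← sub_eq_zero, ← sub_smul, smul_eq_zero] at this
  exact this.resolve_left (sub_ne_zero.mpr (by rwa [mul_assoc] at hk))

theorem eq_zero_of_mul_ne (S : StandardSp a b c) {χ : Fin n → ℝ} {v : V} (hv : IsWeight a χ v)
    {k l : Fin n} (hkl : k ≠ l) (h : χ k * χ l ≠ 0) : v = 0 := by
  have := congrArg (· v) (S.orthogonal k l hkl)
  simp only [End.mul_apply, hv k, hv l, map_smul, smul_smul, LinearMap.zero_apply,
    smul_eq_zero] at this
  exact this.resolve_left (by rwa [mul_comm] at h)

theorem a_apply_eq_zero (S : StandardSp a b c) {j : Fin n} {v : V}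
    (hv : IsWeight a (Pi.single j 1) v) {k l : Fin n} (h : l ≠ j) : a k l v = 0 := by
  by_cases hkl : k = l
  · subst hkl
    rw [hv k, Pi.single_eq_of_ne h, zero_smul]
  have hw := S.isWeight_a hv k l
  by_cases hkj : k = j
  · subst hkj
    refine S.eq_zero_of_cube_ne hw k ?_
    simp [Pi.single_eq_of_ne hkl]; norm_num
  · refine S.eq_zero_of_mul_ne hw hkl ?_
    simp [hkl, hkj, h, Ne.symm hkl]

theorem b_apply_eq_zero (S : StandardSp a b c) {j : Fin n} {v : V}
    (hv : IsWeight a (Pi.single j 1) v) (k l : Fin n) : b k l v = 0 := by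
  have hw := S.isWeight_b hv k l
  by_cases h : k = l ∨ k = j
  · refine S.eq_zero_of_cube_ne hw k ?_
    simp only [Pi.add_apply, Pi.single_apply]
    split_ifs <;> grind
  · push Not at h
    by_cases hlj : l = j
    · refine S.eq_zero_of_cube_ne hw l ?_
      simp only [Pi.add_apply, Pi.single_apply]
      split_ifs <;> grind
    · refine S.eq_zero_of_mul_ne hw h.1 ?_
      simp [h.1, h.2, hlj, h.1.symm]

theorem c_apply_eq_zero (S : StandardSp a b c) {j : Fin n} {v : V}
    (hv : IsWeight a (Pi.single j 1) v) {k l : Fin n} (hk : k ≠ j) (hl : l ≠ j) :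
    c k l v = 0 := by
  have hw := S.isWeight_c hv k l
  by_cases h : k = l
  · refine S.eq_zero_of_cube_ne hw k ?_
    subst h
    simp [hk]; norm_num
  · refine S.eq_zero_of_mul_ne hw h ?_
    simp [h, Ne.symm h, hk, hl]

theorem c_apply_neg_eq_zero (S : StandardSp a b c) {j : Fin n} {v : V}
    (hv : IsWeight a (-Pi.single j 1) v) (k l : Fin n) : c k l v = 0 := by
  have hw := S.isWeight_c hv k l
  by_cases h : k = l ∨ k = j
  · refine S.eq_zero_of_cube_ne hw k ?_
    simp only [Pi.add_apply, Pi.sub_apply, Pi.neg_apply, Pi.single_apply]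
    split_ifs <;> grind
  · push Not at h
    by_cases hlj : l = j
    · refine S.eq_zero_of_cube_ne hw l ?_
      simp only [Pi.add_apply, Pi.sub_apply, Pi.neg_apply, Pi.single_apply]
      split_ifs <;> grind
    · refine S.eq_zero_of_mul_ne hw h.1 ?_
      simp [h.1, h.2, hlj, h.1.symm]

/-- The operators carrying a vector of weight `eₒ` to the other vectors of a standard basis of the
copy of `ℝ²ⁿ` that it generates. -/
noncomputable def transport (a c : Fin n → Fin n → End ℝ V) (o : Fin n) : Idx n → End ℝ V :=
  Sum.elim (fun i ↦ a i o) fun i ↦ (1 / 2 : ℝ) • (c i i * a i o)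

section

variable {o : Fin n} {u : V}

theorem isWeight_a_apply (S : StandardSp a b c) (hu : IsWeight a (Pi.single o 1) u) (i : Fin n) :
    IsWeight a (Pi.single i 1) (a i o u) := by
  convert S.isWeight_a hu i o using 1
  abel

theorem a_self_apply (hu : IsWeight a (Pi.single o 1) u) : a o o u = u := by
  rw [hu o]; simp

theorem isWeight_c_apply (S : StandardSp a b c) (hu : IsWeight a (Pi.single o 1) u) :
    IsWeight a (-Pi.single o 1) (c o o u) := by
  convert S.isWeight_c hu o o using 1
  abel

theorem a_a_apply (S : StandardSp a b c) (hu : IsWeight a (Pi.single o 1) u) (k l j : Fin n) :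
    a k l (a j o u) = if l = j then a k o u else 0 := by
  split_ifs with h
  · subst h
    have := congrArg (· u) (S.aa k l l o)
    simp only [LinearMap.sub_apply, End.mul_apply, if_true] at this
    by_cases hlo : l = o
    · subst hlo; rw [a_self_apply hu]
    · rw [S.a_apply_eq_zero hu hlo, map_zero, sub_zero] at this
      rw [this]
      by_cases hok : o = k
      · subst hok
        simp [a_apply_eq_zero S hu hlo]
      · simp [hok]
  · exact S.a_apply_eq_zero (S.isWeight_a_apply hu j) h

theorem c_diag_a_apply (S : StandardSp a b c) (hu : IsWeight a (Pi.single o 1) u) {i j : Fin n}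
    (h : i ≠ j) : c i i (a j o u) = 0 :=
  S.c_apply_eq_zero (S.isWeight_a_apply hu j) h h

theorem c_a_apply (S : StandardSp a b c) (hu : IsWeight a (Pi.single o 1) u) (k l j : Fin n) :
    c k l (a j o u) = (if l = j then transport a c o (.inr k) u else 0) +
      if k = j then transport a c o (.inr l) u else 0 := by
  -- Apply `[a k j, c k k] = -2 c k j` to `a j o u`, which `c k k` kills.
  have key : ∀ k j, k ≠ j → c k j (a j o u) = transport a c o (.inr k) u := by
    intro k j hkj
    have h1 := congrArg (· (a j o u)) (S.ac k j k k)
    simp only [LinearMap.sub_apply, LinearMap.neg_apply, LinearMap.add_apply, End.mul_apply,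
      if_true, S.a_a_apply hu, S.c_diag_a_apply hu hkj, map_zero, zero_sub, neg_inj] at h1
    simp only [transport, Sum.elim_inr, LinearMap.smul_apply, End.mul_apply, h1]
    module
  by_cases hl : l = j
  · subst hl
    by_cases hk : k = l
    · subst hk
      simp only [if_true, transport, Sum.elim_inr, LinearMap.smul_apply, End.mul_apply]
      module
    · simp [hk, key k l hk]
  · by_cases hk : k = j
    · subst hk
      rw [S.c_symm, key l k hl]
      simp [hl]
    · simp [hl, hk, S.c_apply_eq_zero (S.isWeight_a_apply hu j) hk hl]

theorem isWeight_transport_inr (S : StandardSp a b c) (hu : IsWeight a (Pi.single o 1) u)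
    (j : Fin n) : IsWeight a (-Pi.single j 1) (transport a c o (.inr j) u) := by
  intro i
  have := S.isWeight_c_apply (S.isWeight_a_apply hu j) i
  simp only [transport, Sum.elim_inr, LinearMap.smul_apply, End.mul_apply, map_smul, this,
    smul_comm (1 / 2 : ℝ)]

theorem c_transport_inr (S : StandardSp a b c) (hu : IsWeight a (Pi.single o 1) u)
    (k l j : Fin n) : c k l (transport a c o (.inr j) u) = 0 :=
  S.c_apply_neg_eq_zero (S.isWeight_transport_inr hu j) k l

theorem a_transport_inr (S : StandardSp a b c) (hu : IsWeight a (Pi.single o 1) u)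
    (k l j : Fin n) : a k l (transport a c o (.inr j) u) =
      -(if k = j then transport a c o (.inr l) u else 0) := by
  have h1 := congrArg (· (a j o u)) (S.ac k l j j)
  simp only [LinearMap.sub_apply, End.mul_apply, S.a_a_apply hu, sub_eq_iff_eq_add] at h1
  rw [transport, Sum.elim_inr, LinearMap.smul_apply, End.mul_apply, map_smul, h1]
  have h2 := S.c_a_apply hu j l j
  have h3 := S.c_a_apply hu l j j
  have h4 := S.c_a_apply hu j j k
  have h5 := S.c_a_apply hu j j j
  simp only [transport, Sum.elim_inr] at h2 h3 h4 h5 ⊢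
  by_cases hk : k = j
  · subst hk
    by_cases hl : l = k
    · subst hl
      simp only [if_true, LinearMap.neg_apply, LinearMap.add_apply, LinearMap.smul_apply,
        End.mul_apply]
      module
    · simp only [if_true, if_false, hl, zero_add, add_zero, LinearMap.neg_apply,
        LinearMap.add_apply, map_zero] at h2 h3 ⊢
      rw [S.c_symm l k] at h3
      rw [h3]
      module
  · by_cases hl : l = j
    · subst hl
      simp only [hk, Ne.symm hk, if_true, if_false, add_zero] at h4 ⊢
      simp [h4]
    · simp [hk, hl, Ne.symm hk]

theorem b_transport_inr (S : StandardSp a b c) (hu : IsWeight a (Pi.single o 1) u)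
    (k l j : Fin n) : b k l (transport a c o (.inr j) u) =
      (if l = j then a k o u else 0) + if k = j then a l o u else 0 := by
  have h1 := congrArg (· (a j o u)) (S.bc k l j j)
  simp only [LinearMap.sub_apply, End.mul_apply, S.b_apply_eq_zero (S.isWeight_a_apply hu j),
    map_zero, sub_zero] at h1
  rw [transport, Sum.elim_inr, LinearMap.smul_apply, End.mul_apply, map_smul, h1]
  by_cases hl : l = j <;> by_cases hk : k = j <;>
    simp only [hl, hk, if_true, if_false, LinearMap.add_apply, LinearMap.zero_apply,
      S.a_a_apply hu] <;> module

theorem b_a_apply (S : StandardSp a b c) (hu : IsWeight a (Pi.single o 1) u)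
    (k l j : Fin n) : b k l (a j o u) = 0 :=
  S.b_apply_eq_zero (S.isWeight_a_apply hu j) k l

end

/-- One-sided inverses of the transport operators. -/
noncomputable def coTransport (a b : Fin n → Fin n → End ℝ V) (o : Fin n) : Idx n → End ℝ V :=
  -- On `topSpace` the factor `a² + a` is multiplication by `2`, which explains `1/2`; in the second
  -- block `b i i` contributes another `2`.
  Sum.elim (fun i ↦ (1 / 2 : ℝ) • ((a o o * a o o + a o o) * a o i))
    fun i ↦ (1 / 4 : ℝ) • ((a o o * a o o + a o o) * a o i * b i i)

theorem coTransport_transport (S : StandardSp a b c) {o : Fin n} {u : V}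
    (hu : IsWeight a (Pi.single o 1) u) (x y : Idx n) :
    coTransport a b o x (transport a c o y u) = if x = y then u else 0 := by
  have hoo := a_self_apply hu
  rcases x with i | i <;> rcases y with j | j
  · simp only [coTransport, Sum.elim_inl, transport, LinearMap.smul_apply, End.mul_apply,
      S.a_a_apply hu, LinearMap.add_apply, Sum.inl.injEq]
    split_ifs with h
    · simp only [hoo]; module
    · simp
  · simp only [coTransport, Sum.elim_inl, LinearMap.smul_apply, End.mul_apply,
      S.a_transport_inr hu, LinearMap.add_apply, reduceCtorEq, if_false, map_neg]
    split_ifs with h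
    · by_cases ho : o = i
      · subst ho
        simp [S.a_transport_inr hu]
      · simp [S.a_transport_inr hu, ho]
    · simp
  · simp only [coTransport, Sum.elim_inr, transport, Sum.elim_inl, LinearMap.smul_apply,
      End.mul_apply, S.b_a_apply hu, map_zero, smul_zero, reduceCtorEq, if_false]
  · simp only [coTransport, Sum.elim_inr, LinearMap.smul_apply, End.mul_apply,
      S.b_transport_inr hu, LinearMap.add_apply, map_add, Sum.inr.injEq]
    split_ifs with h
    · subst h
      simp only [S.a_a_apply hu, if_true, hoo]
      module
    · simp

/-- The space of vectors of weight `eₒ`. -/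
def topSpace (a : Fin n → Fin n → End ℝ V) (o : Fin n) : Submodule ℝ V where
  carrier := {v | IsWeight a (Pi.single o 1) v}
  add_mem' hv hw i := by rw [map_add, hv i, hw i, smul_add]
  zero_mem' i := by simp
  smul_mem' r v hv i := by rw [map_smul, hv i, smul_comm]

theorem mem_topSpace {o : Fin n} {v : V} : v ∈ topSpace a o ↔ IsWeight a (Pi.single o 1) v :=
  Iff.rfl

/-- The map `ℝ²ⁿ ⊗ topSpace → V` assembled from the transport operators. -/
noncomputable def assemble (a c : Fin n → Fin n → End ℝ V) (o : Fin n) :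
    (Idx n → topSpace a o) →ₗ[ℝ] V :=
  ∑ x, (transport a c o x ∘ₗ (topSpace a o).subtype) ∘ₗ LinearMap.proj x

theorem assemble_apply (o : Fin n) (y : Idx n → topSpace a o) :
    assemble a c o y = ∑ x, transport a c o x (y x) := by
  simp [assemble, LinearMap.sum_apply]

theorem assemble_injective (S : StandardSp a b c) (o : Fin n) :
    Function.Injective (assemble a c o) := by
  rw [injective_iff_map_eq_zero]
  intro y hy
  ext x
  have := congrArg (coTransport a b o x) hy
  simp only [assemble_apply, map_sum, map_zero, S.coTransport_transport (y _).2,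
    Finset.sum_ite_eq, Finset.mem_univ, if_true] at this
  simpa using this

theorem two_mul_finrank_topSpace_le [FiniteDimensional ℝ V] (S : StandardSp a b c) (o : Fin n) :
    2 * n * finrank ℝ (topSpace a o) ≤ finrank ℝ V := by
  have := LinearMap.finrank_le_finrank_of_injective (S.assemble_injective o)
  rw [finrank_pi_fintype] at this
  simpa [two_mul] using this

/-- As `D³ = D`, the operators `D² + D` and `D² - D` are twice the projections onto the eigenspaces
for `1` and `-1`. -/
theorem isWeight_plus (S : StandardSp a b c) (o : Fin n) (v : V) :
    IsWeight a (Pi.single o 1) (a o o (a o o v) + a o o v) := by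
  have h3 : a o o (a o o (a o o v)) = a o o v := congrArg (· v) (S.cubed o)
  intro i
  by_cases hi : i = o
  · subst hi
    rw [map_add, h3]; simp [add_comm]
  · have h4 : ∀ v, a i i (a o o v) = 0 := fun v ↦ congrArg (· v) (S.orthogonal i o hi)
    rw [map_add, h4, h4]; simp [hi]

theorem isWeight_minus (S : StandardSp a b c) (o : Fin n) (v : V) :
    IsWeight a (-Pi.single o 1) (a o o (a o o v) - a o o v) := by
  have h3 : a o o (a o o (a o o v)) = a o o v := congrArg (· v) (S.cubed o)
  intro i
  by_cases hi : i = o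
  · subst hi
    rw [map_sub, h3]; simp
  · have h4 : ∀ v, a i i (a o o v) = 0 := fun v ↦ congrArg (· v) (S.orthogonal i o hi)
    rw [map_sub, h4, h4]; simp [hi]

theorem b_apply_mem_topSpace (S : StandardSp a b c) {o : Fin n} {w : V}
    (hw : IsWeight a (-Pi.single o 1) w) : b o o w ∈ topSpace a o := by
  rw [mem_topSpace]
  convert S.isWeight_b hw o o using 1
  abel

theorem c_b_apply (S : StandardSp a b c) {o : Fin n} {w : V}
    (hw : IsWeight a (-Pi.single o 1) w) : c o o (b o o w) = (4 : ℝ) • w := by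
  have h6 := congrArg (· w) (S.bc o o o o)
  have h7 : a o o w = -w := by rw [hw o]; simp
  simp only [if_true, LinearMap.sub_apply, LinearMap.add_apply, End.mul_apply,
    S.c_apply_neg_eq_zero hw, map_zero, zero_sub, h7] at h6
  rw [← neg_inj, h6]; module

/-- The form `(u, u') ↦ B u (c u')` on `topSpace` is nondegenerate. -/
theorem exists_pairing_ne_zero (S : StandardSp a b c) (B : LinearMap.BilinForm ℝ V)
    (hB : ∀ v, v ≠ 0 → ∃ w, B v w ≠ 0) {o : Fin n} (hBa : ∀ v w, B (a o o v) w = -B v (a o o w))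
    {u : V} (hu : u ∈ topSpace a o) (hu0 : u ≠ 0) : ∃ u' ∈ topSpace a o, B u (c o o u') ≠ 0 := by
  obtain ⟨w, hw⟩ := hB u hu0
  -- Skewness of `a o o` makes `u` pair only with the component of `w` of weight `-eₒ`, and `c b =
  -- 4` there puts this component in the image of `c`.
  have hwt := S.isWeight_minus o w
  refine ⟨_, S.b_apply_mem_topSpace hwt, ?_⟩
  have h5 : ∀ v, B u (a o o v) = -B u v := fun v ↦ by
    rw [← neg_eq_iff_eq_neg, ← hBa, a_self_apply hu]
  rw [S.c_b_apply hwt, map_smul, map_sub, h5, h5, smul_eq_mul]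
  intro h0
  apply hw
  linarith

/-- If `topSpace` vanished, so would both components `D² ± D`: the second is carried into `topSpace`
by `b o o`, which is injective on weight `-eₒ`. Their difference is `2D`. -/
theorem topSpace_ne_bot (S : StandardSp a b c) {o : Fin n} (h : a o o ≠ 0) : topSpace a o ≠ ⊥ := by
  intro hbot
  apply h
  ext v
  have h1 : a o o (a o o v) + a o o v ∈ topSpace a o := S.isWeight_plus o v
  have h2 := S.b_apply_mem_topSpace (S.isWeight_minus o v)
  have h3 := S.c_b_apply (S.isWeight_minus o v)
  rw [hbot, Submodule.mem_bot] at h1 h2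
  rw [h2, map_zero, eq_comm, smul_eq_zero, or_iff_right (by norm_num)] at h3
  have h9 : (2 : ℝ) • a o o v = (a o o (a o o v) + a o o v) - (a o o (a o o v) - a o o v) := by
    module
  rw [h1, h3, sub_zero, smul_eq_zero, or_iff_right (by norm_num)] at h9
  exact h9

/-- The pairing `B u (c u')` is nondegenerate, and symmetry of `B` with skewness of `c` makes it
alternating, so dimension `1` is impossible; the injection of `ℝ²ⁿ ⊗ topSpace` bounds the dimension
by `2`. -/
theorem finrank_topSpace [FiniteDimensional ℝ V] (S : StandardSp a b c) (hn : 0 < n)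
    (hV : finrank ℝ V = 4 * n) (B : LinearMap.BilinForm ℝ V) (hBs : ∀ v w, B v w = B w v)
    (hB : ∀ v, v ≠ 0 → ∃ w, B v w ≠ 0) {o : Fin n} (hBa : ∀ v w, B (a o o v) w = -B v (a o o w))
    (hBc : ∀ v w, B (c o o v) w = -B v (c o o w)) (h : a o o ≠ 0) :
    finrank ℝ (topSpace a o) = 2 := by
  have hle := S.two_mul_finrank_topSpace_le o
  have h2 : finrank ℝ (topSpace a o) ≤ 2 := by
    rw [hV] at hle
    by_contra hcon
    have : 2 * n * 3 ≤ 2 * n * finrank ℝ (topSpace a o) := Nat.mul_le_mul_left _ (by lia)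
    lia
  obtain ⟨u, hu, hu0⟩ := Submodule.exists_mem_ne_zero_of_ne_bot (S.topSpace_ne_bot h)
  obtain ⟨u', hu', hp⟩ := S.exists_pairing_ne_zero B hB hBa hu hu0
  by_contra hne
  have h1 : finrank ℝ (topSpace a o) ≤ 1 := by lia
  obtain ⟨r, hr⟩ := (finrank_le_one_iff.mp h1)
  obtain ⟨s, hs⟩ := hr ⟨u, hu⟩
  obtain ⟨t, ht⟩ := hr ⟨u', hu'⟩
  have hs' : s • (r : V) = u := congrArg Subtype.val hs
  have ht' : t • (r : V) = u' := congrArg Subtype.val ht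
  have hrr : B (r : V) (c o o r) = 0 := by
    have h3 := hBc (r : V) r
    rw [hBs] at h3
    linarith
  rw [← hs', ← ht'] at hp
  simp [hrr] at hp

theorem assemble_surjective [FiniteDimensional ℝ V] (S : StandardSp a b c)
    (hV : finrank ℝ V = 4 * n) {o : Fin n} (h2 : finrank ℝ (topSpace a o) = 2) :
    Function.Surjective (assemble a c o) := by
  refine (LinearMap.injective_iff_surjective_of_finrank_eq_finrank ?_).mp (S.assemble_injective o)
  rw [finrank_pi_fintype]
  simp [h2, hV]
  ring

end StandardSp

end SplitInclusion

/-! ### The commuting `𝔰𝔩₂` on the two-dimensional multiplicity space. -/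

namespace SplitInclusion

open Module

theorem SlTriple.restrict {V : Type*} [AddCommGroup V] [Module ℝ V] {h e f : End ℝ V}
    (t : SlTriple h e f) (p : Submodule ℝ V) (hh : ∀ v ∈ p, h v ∈ p) (he : ∀ v ∈ p, e v ∈ p)
    (hf : ∀ v ∈ p, f v ∈ p) :
    SlTriple (h.restrict hh : End ℝ p) (e.restrict he : End ℝ p) (f.restrict hf : End ℝ p) where
  ef := by
    ext v
    exact congrArg (· (v : V)) t.ef
  he := by
    ext v
    exact congrArg (· (v : V)) t.he
  hf := by
    ext v
    exact congrArg (· (v : V)) t.hf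

theorem SlTriple.e_sq_eq_zero_of_finrank {V : Type*} [AddCommGroup V] [Module ℝ V]
    [FiniteDimensional ℝ V] {h e f : End ℝ V} (t : SlTriple h e f) (h2 : finrank ℝ V = 2) :
    e * e = 0 := by
  obtain ⟨N, hN⟩ := t.e_isNilpotent
  have := End.ker_pow_le_ker_pow_finrank e N
  rw [hN, h2, pow_two] at this
  ext v
  exact this (by simp : v ∈ LinearMap.ker (0 : End ℝ V))

namespace StandardSp

open SpRelations

variable {n : ℕ} {V : Type*} [AddCommGroup V] [Module ℝ V] {a b c : Fin n → Fin n → End ℝ V}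

theorem apply_mem_topSpace {o : Fin n} {g : End ℝ V} (hg : ∀ i, Commute g (a i i)) {v : V}
    (hv : v ∈ topSpace a o) : g v ∈ topSpace a o := by
  intro i
  rw [← End.mul_apply, ← (hg i).eq, End.mul_apply, hv i, map_smul]

theorem commute_transport {o : Fin n} {g : End ℝ V} (hga : ∀ i j, Commute g (a i j))
    (hgc : ∀ i j, Commute g (c i j)) (x : Idx n) : Commute g (transport a c o x) := by
  rcases x with i | i
  · exact hga i o
  · exact ((hgc i i).mul_right (hga i o)).smul_right _

/-- The operator `e` commutes with the transport operators, whose images of `topSpace` span `V`; so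
`e ≠ 0` forces `e w ≠ 0` for some `w` in `topSpace`. There `e² = f² = 0` by dimension, and `u = e
w`, `f u` behave as the standard basis of `ℝ²`. -/
theorem exists_sl_vector [FiniteDimensional ℝ V] {o : Fin n} (h2 : finrank ℝ (topSpace a o) = 2)
    (hsurj : Function.Surjective (assemble a c o)) {h e f : End ℝ V} (t : SlTriple h e f)
    (hha : ∀ i j, Commute h (a i j)) (hea : ∀ i j, Commute e (a i j))
    (hfa : ∀ i j, Commute f (a i j)) (hec : ∀ i j, Commute e (c i j)) (he0 : e ≠ 0) :
    ∃ u ∈ topSpace a o, u ≠ 0 ∧ f u ∈ topSpace a o ∧ e u = 0 ∧ h u = u ∧ e (f u) = u ∧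
      f (f u) = 0 ∧ h (f u) = -f u := by
  have hU : ∀ {g : End ℝ V}, (∀ i j, Commute g (a i j)) →
      ∀ v ∈ topSpace a o, g v ∈ topSpace a o :=
    fun hg v hv ↦ apply_mem_topSpace (fun i ↦ hg i i) hv
  have r := t.restrict (topSpace a o) (hU hha) (hU hea) (hU hfa)
  have hee := r.e_sq_eq_zero_of_finrank h2
  have hff := r.symm.e_sq_eq_zero_of_finrank h2
  have hefe := r.efe_of_sq_eq_zero hee
  have hhe := r.h_mul_e_of_sq_eq_zero hee
  have hhf := r.symm.h_mul_e_of_sq_eq_zero hff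
  obtain ⟨w, hw, hew⟩ : ∃ w ∈ topSpace a o, e w ≠ 0 := by
    by_contra hcon
    push Not at hcon
    apply he0
    ext v
    obtain ⟨y, rfl⟩ := hsurj v
    rw [assemble_apply, map_sum, LinearMap.zero_apply]
    refine Finset.sum_eq_zero fun x _ ↦ ?_
    rw [← End.mul_apply, (commute_transport hea hec x).eq, End.mul_apply, hcon _ (y x).2, map_zero]
  have hu := hU hea w hw
  have hval : ∀ {g : End ℝ (topSpace a o)} {g' : End ℝ (topSpace a o)} (_ : g = g')
      (v : topSpace a o), (g v : V) = g' v := fun hg v ↦ by rw [hg]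
  refine ⟨e w, hu, hew, hU hfa _ hu, hval hee ⟨w, hw⟩, hval hhe ⟨w, hw⟩, hval hefe ⟨w, hw⟩,
    hval hff ⟨e w, hu⟩, ?_⟩
  have := hval hhf ⟨e w, hu⟩
  rw [← neg_eq_iff_eq_neg]
  exact this

end StandardSp

end SplitInclusion

/-! ### Block coordinates on `𝔰𝔭(n, ℝ)` and its representations. -/

namespace SplitInclusion

open Module Matrix

variable {n : ℕ}

theorem mem_spR_iff {M : Matrix (Idx n) (Idx n) ℝ} :
    M ∈ spR n ↔ Mᵀ * Matrix.J (Fin n) ℝ = -(Matrix.J (Fin n) ℝ * M) := by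
  change M ∈ skewAdjointMatricesLieSubalgebra _ ↔ _
  rw [mem_skewAdjointMatricesLieSubalgebra, mem_skewAdjointMatricesSubmodule,
    Matrix.IsSkewAdjoint, Matrix.IsAdjointPair, mul_neg]

theorem fromBlocks_mem_spR_iff {A B C D : Matrix (Fin n) (Fin n) ℝ} :
    fromBlocks A B C D ∈ spR n ↔ D = -Aᵀ ∧ Bᵀ = B ∧ Cᵀ = C := by
  rw [mem_spR_iff, Matrix.J, fromBlocks_transpose, fromBlocks_multiply, fromBlocks_multiply,
    fromBlocks_neg, fromBlocks_inj]
  simp only [mul_zero, mul_one, zero_add, mul_neg, add_zero, zero_mul, neg_mul, one_mul, neg_neg,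
    neg_inj]
  constructor
  · rintro ⟨h1, h2, h3, h4⟩
    exact ⟨h2.symm, h4, h1⟩
  · rintro ⟨h1, h2, h3⟩
    subst h1
    simp [h2, h3]

/-- The element `[A, 0; 0, -Aᵀ]` of `𝔰𝔭(n, ℝ)`. -/
def spGl : Matrix (Fin n) (Fin n) ℝ →ₗ[ℝ] spR n where
  toFun A := ⟨fromBlocks A 0 0 (-Aᵀ), fromBlocks_mem_spR_iff.mpr (by simp)⟩
  map_add' A B := by ext1; simp [fromBlocks_add, add_comm]
  map_smul' r A := by ext1; simp [fromBlocks_smul]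

/-- The element `[0, B + Bᵀ; 0, 0]` of `𝔰𝔭(n, ℝ)`. -/
def spUp : Matrix (Fin n) (Fin n) ℝ →ₗ[ℝ] spR n where
  toFun B := ⟨fromBlocks 0 (B + Bᵀ) 0 0, fromBlocks_mem_spR_iff.mpr (by simp [add_comm])⟩
  map_add' A B := by ext1; simp [fromBlocks_add, add_add_add_comm]
  map_smul' r A := by ext1; simp [fromBlocks_smul]

/-- The element `[0, 0; C + Cᵀ, 0]` of `𝔰𝔭(n, ℝ)`. -/
def spLow : Matrix (Fin n) (Fin n) ℝ →ₗ[ℝ] spR n where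
  toFun C := ⟨fromBlocks 0 0 (C + Cᵀ) 0, fromBlocks_mem_spR_iff.mpr (by simp [add_comm])⟩
  map_add' A B := by ext1; simp [fromBlocks_add, add_add_add_comm]
  map_smul' r A := by ext1; simp [fromBlocks_smul]

theorem coe_spGl (A : Matrix (Fin n) (Fin n) ℝ) :
    (spGl A : Matrix (Idx n) (Idx n) ℝ) = fromBlocks A 0 0 (-Aᵀ) := rfl

theorem coe_spUp (A : Matrix (Fin n) (Fin n) ℝ) :
    (spUp A : Matrix (Idx n) (Idx n) ℝ) = fromBlocks 0 (A + Aᵀ) 0 0 := rfl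

theorem coe_spLow (A : Matrix (Fin n) (Fin n) ℝ) :
    (spLow A : Matrix (Idx n) (Idx n) ℝ) = fromBlocks 0 0 (A + Aᵀ) 0 := rfl

theorem spGl_lie_spGl (A B : Matrix (Fin n) (Fin n) ℝ) :
    ⁅spGl A, spGl B⁆ = spGl (A * B - B * A) := by
  ext1
  simp [coe_spGl, LieSubalgebra.coe_bracket, Ring.lie_def, fromBlocks_multiply, sub_eq_add_neg,
    fromBlocks_neg, fromBlocks_add, add_comm]

theorem spGl_lie_spUp (A B : Matrix (Fin n) (Fin n) ℝ) :
    ⁅spGl A, spUp B⁆ = spUp (A * (B + Bᵀ)) := by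
  ext1
  simp [coe_spGl, coe_spUp, LieSubalgebra.coe_bracket, Ring.lie_def, fromBlocks_multiply,
    sub_eq_add_neg, fromBlocks_neg, fromBlocks_add, add_comm B]

theorem spGl_lie_spLow (A C : Matrix (Fin n) (Fin n) ℝ) :
    ⁅spGl A, spLow C⁆ = -spLow ((C + Cᵀ) * A) := by
  ext1
  simp [coe_spGl, coe_spLow, LieSubalgebra.coe_bracket, Ring.lie_def, fromBlocks_multiply,
    sub_eq_add_neg, fromBlocks_neg, fromBlocks_add, add_comm C]

theorem spUp_lie_spLow (B C : Matrix (Fin n) (Fin n) ℝ) :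
    ⁅spUp B, spLow C⁆ = spGl ((B + Bᵀ) * (C + Cᵀ)) := by
  ext1
  simp [coe_spGl, coe_spUp, coe_spLow, LieSubalgebra.coe_bracket, Ring.lie_def,
    fromBlocks_multiply, sub_eq_add_neg, fromBlocks_neg, fromBlocks_add, transpose_mul, add_comm B, add_comm C]

theorem spUp_transpose (B : Matrix (Fin n) (Fin n) ℝ) : spUp Bᵀ = spUp B := by
  ext1
  simp [coe_spUp, add_comm]

theorem spLow_transpose (B : Matrix (Fin n) (Fin n) ℝ) : spLow Bᵀ = spLow B := by
  ext1
  simp [coe_spLow, add_comm]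

/-- The halves occur because `spUp` and `spLow` double a symmetric block. -/
theorem spR_eq_blocks (x : spR n) :
    x = spGl (toBlocks₁₁ x.1) + (1 / 2 : ℝ) • spUp (toBlocks₁₂ x.1) +
      (1 / 2 : ℝ) • spLow (toBlocks₂₁ x.1) := by
  obtain ⟨M, hM⟩ := x
  rw [← fromBlocks_toBlocks M, fromBlocks_mem_spR_iff] at hM
  obtain ⟨h1, h2, h3⟩ := hM
  ext1
  have h4 : ∀ X : Matrix (Fin n) (Fin n) ℝ, (1 / 2 : ℝ) • (X + X) = X := fun X ↦ by module
  change M = (spGl M.toBlocks₁₁ : Matrix (Idx n) (Idx n) ℝ) +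
    (1 / 2 : ℝ) • (spUp M.toBlocks₁₂ : Matrix (Idx n) (Idx n) ℝ) +
    (1 / 2 : ℝ) • (spLow M.toBlocks₂₁ : Matrix (Idx n) (Idx n) ℝ)
  simp only [coe_spGl, coe_spUp, coe_spLow,
    fromBlocks_smul, fromBlocks_add, h2, h3, h4, smul_zero, zero_add, add_zero, ← h1,
    fromBlocks_toBlocks]

variable {V : Type*} [AddCommGroup V] [Module ℝ V]

theorem single_mul_single (i j k l : Fin n) :
    single i j (1 : ℝ) * single k l 1 = if j = k then single i l 1 else 0 := by
  split_ifs with h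
  · subst h; simp
  · simp [h]

theorem spRelations (ρ : spR n →ₗ⁅ℝ⁆ End ℝ V) :
    SpRelations (fun i j ↦ ρ (spGl (single i j 1))) (fun i j ↦ ρ (spUp (single i j 1)))
      (fun i j ↦ ρ (spLow (single i j 1))) where
  b_symm i j := by rw [← spUp_transpose, transpose_single]
  c_symm i j := by rw [← spLow_transpose, transpose_single]
  aa i j k l := by
    rw [← Ring.lie_def, ← LieHom.map_lie, spGl_lie_spGl, single_mul_single, single_mul_single,
      map_sub, map_sub, apply_ite spGl, apply_ite spGl, apply_ite ρ, apply_ite ρ, map_zero, map_zero]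
  ab i j k l := by
    rw [← Ring.lie_def, ← LieHom.map_lie, spGl_lie_spUp, transpose_single, mul_add,
      single_mul_single, single_mul_single, map_add, map_add, apply_ite spUp, apply_ite spUp,
      apply_ite ρ, apply_ite ρ, map_zero, map_zero]
  ac i j k l := by
    rw [← Ring.lie_def, ← LieHom.map_lie, spGl_lie_spLow, transpose_single, add_mul,
      single_mul_single, single_mul_single, map_neg, map_add, map_add, apply_ite spLow,
      apply_ite spLow, apply_ite ρ, apply_ite ρ, map_zero, map_zero, add_comm]
  bc i j k l := by
    rw [← Ring.lie_def, ← LieHom.map_lie, spUp_lie_spLow, transpose_single, transpose_single,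
      add_mul, mul_add, mul_add]
    simp only [single_mul_single, map_add, apply_ite spGl, apply_ite ρ, map_zero]

-- Each `u` of weight `eₒ` gives an equivariant map `ℝ²ⁿ → V` sending the basis vector `y` to
-- `transport y u`. By linearity this reduces to the action of root vectors on the transported
-- vectors.
open StandardSp in
theorem map_apply_transport (ρ : spR n →ₗ⁅ℝ⁆ End ℝ V)
    (S : StandardSp (fun i j ↦ ρ (spGl (single i j 1))) (fun i j ↦ ρ (spUp (single i j 1)))
      (fun i j ↦ ρ (spLow (single i j 1)))) {o : Fin n} {u : V}
    (hu : u ∈ topSpace (fun i j ↦ ρ (spGl (single i j 1))) o) (x : spR n) (y : Idx n) :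
    ρ x (transport (fun i j ↦ ρ (spGl (single i j 1))) (fun i j ↦ ρ (spLow (single i j 1))) o y u) =
      ∑ z, x.1 z y •
        transport (fun i j ↦ ρ (spGl (single i j 1))) (fun i j ↦ ρ (spLow (single i j 1))) o z u := by
  set T := transport (fun i j ↦ ρ (spGl (single i j 1))) (fun i j ↦ ρ (spLow (single i j 1))) o
    with hT
  have hTl : ∀ i, T (.inl i) = ρ (spGl (single i o 1)) := fun i ↦ rfl
  have hexp : ∀ (F : Matrix (Fin n) (Fin n) ℝ →ₗ[ℝ] spR n) (A : Matrix (Fin n) (Fin n) ℝ) (v : V),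
      ρ (F A) v = ∑ k, ∑ l, A k l • ρ (F (single k l 1)) v := by
    intro F A v
    conv_lhs => rw [matrix_eq_sum_single A]
    simp only [map_sum, LinearMap.sum_apply]
    refine Finset.sum_congr rfl fun k _ ↦ Finset.sum_congr rfl fun l _ ↦ ?_
    rw [← LinearMap.smul_apply, ← map_smul, ← map_smul, smul_single, smul_eq_mul, mul_one]
  have e1 := S.a_a_apply hu
  have e2 := S.b_a_apply hu
  have e3 := S.c_a_apply hu
  have e4 := S.a_transport_inr hu
  have e5 := S.b_transport_inr hu
  have e6 := S.c_transport_inr hu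
  rw [← hT] at e3 e4 e5 e6
  simp only [← hTl] at e1 e2 e3 e5
  obtain ⟨M, hM⟩ := x
  have hx := spR_eq_blocks ⟨M, hM⟩
  rw [hx, map_add, map_add, map_smul, map_smul, LinearMap.add_apply, LinearMap.add_apply,
    LinearMap.smul_apply, LinearMap.smul_apply, hexp, hexp, hexp, Fintype.sum_sum_type]
  rw [← hx]
  have hM' := hM
  rw [← fromBlocks_toBlocks M, fromBlocks_mem_spR_iff] at hM'
  obtain ⟨h1, h2, h3⟩ := hM'
  have g1 : ∀ i j, M (.inr i) (.inr j) = -M (.inl j) (.inl i) := fun i j ↦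
    congrFun (congrFun h1 i) j
  have g2 : ∀ i j, M (.inl i) (.inr j) = M (.inl j) (.inr i) := fun i j ↦
    congrFun (congrFun h2 j) i
  have g3 : ∀ i j, M (.inr i) (.inl j) = M (.inr j) (.inl i) := fun i j ↦
    congrFun (congrFun h3 j) i
  rcases y with j | j
  · simp only [e1, e2, e3, smul_zero, Finset.sum_const_zero, add_zero, smul_ite, smul_add,
      Finset.sum_ite_eq', Finset.mem_univ, if_true, Finset.sum_add_distrib]
    rw [Finset.sum_comm (f := fun k l ↦ if k = j then _ else _)]
    simp only [Finset.sum_ite_eq', Finset.mem_univ, if_true, toBlocks₁₁, toBlocks₂₁, of_apply,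
      g3 j]
    module
  · simp only [e4, e5, e6, smul_zero, Finset.sum_const_zero, add_zero, smul_ite, smul_add, smul_neg,
      Finset.sum_ite_eq', Finset.mem_univ, if_true, Finset.sum_add_distrib, Finset.sum_neg_distrib]
    rw [Finset.sum_comm (f := fun k l ↦ if k = j then _ else _),
      Finset.sum_comm (f := fun k l ↦ if k = j then _ else _)]
    simp only [Finset.sum_ite_eq', Finset.mem_univ, if_true, toBlocks₁₁, toBlocks₁₂, of_apply,
      g1, g2 j, neg_smul, Finset.sum_neg_distrib]
    module

end SplitInclusion

/-! ### The standard embedding and the associative algebra it generates. -/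

namespace SplitInclusion

open Module Matrix

variable {n : ℕ}

/-- The matrix `[0, I; -I, 0]`. -/
def skewUnit (n : ℕ) : Matrix (Idx n) (Idx n) ℝ := fromBlocks 0 1 (-1) 0

theorem skewUnit_mul_self : skewUnit n * skewUnit n = -1 := by
  rw [skewUnit, fromBlocks_multiply, ← fromBlocks_one, fromBlocks_neg]
  simp

theorem skewUnit_mul_skewUnit_mul (X : Matrix (Idx n) (Idx n) ℝ) :
    skewUnit n * (skewUnit n * X) = -X := by
  rw [← mul_assoc, skewUnit_mul_self, neg_mul, one_mul]

theorem skewUnit_transpose : (skewUnit n)ᵀ = -skewUnit n := by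
  simp [skewUnit, fromBlocks_transpose, fromBlocks_neg]

theorem transpose_mul_skewUnit {M : Matrix (Idx n) (Idx n) ℝ} (hM : M ∈ spR n) :
    Mᵀ * skewUnit n = -(skewUnit n * M) := by
  -- The form defining `spR` is `-K`; the sign does not affect the condition.
  have hJ : Matrix.J (Fin n) ℝ = -skewUnit n := by
    simp [Matrix.J, skewUnit, fromBlocks_neg]
  rwa [mem_spR_iff, hJ, mul_neg, neg_mul, neg_neg, neg_eq_iff_eq_neg] at hM

theorem skewUnit_mul_transpose {M : Matrix (Idx n) (Idx n) ℝ} (hM : M ∈ spR n) :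
    skewUnit n * Mᵀ = -(M * skewUnit n) := by
  have h1 : skewUnit n * (Mᵀ * skewUnit n) * skewUnit n =
      skewUnit n * -(skewUnit n * M) * skewUnit n := by rw [transpose_mul_skewUnit hM]
  rw [mul_assoc, mul_assoc, skewUnit_mul_self, mul_neg, mul_neg, mul_one, mul_neg, ← mul_assoc,
    skewUnit_mul_self] at h1
  simpa [neg_eq_iff_eq_neg] using h1

theorem fromBlocks_mem_soSplit_iff {A B C D : Matrix (Idx n) (Idx n) ℝ} :
    fromBlocks A B C D ∈ soSplit n ↔ D = -Aᵀ ∧ Bᵀ = -B ∧ Cᵀ = -C := by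
  change _ ∈ skewAdjointMatricesLieSubalgebra _ ↔ _
  rw [mem_skewAdjointMatricesLieSubalgebra, mem_skewAdjointMatricesSubmodule,
    Matrix.IsSkewAdjoint, Matrix.IsAdjointPair, mul_neg, LieAlgebra.Orthogonal.JD,
    fromBlocks_transpose, fromBlocks_multiply, fromBlocks_multiply, fromBlocks_neg, fromBlocks_inj]
  simp only [mul_zero, mul_one, zero_add, add_zero, zero_mul, one_mul]
  constructor
  · rintro ⟨h1, h2, h3, h4⟩
    exact ⟨by rw [h2, neg_neg], h4, h1⟩
  · rintro ⟨h1, h2, h3⟩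
    subst h1
    simp [h2, h3]

theorem inclusionMatrix_eq (M : Matrix (Idx n) (Idx n) ℝ) (N : Matrix (Idx 1) (Idx 1) ℝ) :
    inclusionMatrix M N = fromBlocks (M + N (.inl 0) (.inl 0) • 1) (N (.inl 0) (.inr 0) • skewUnit n)
      (-(N (.inr 0) (.inl 0) • skewUnit n)) (-(M + N (.inl 0) (.inl 0) • 1)ᵀ) := rfl

theorem inclusionMatrix_mem (M : Matrix (Idx n) (Idx n) ℝ) (N : Matrix (Idx 1) (Idx 1) ℝ) :
    inclusionMatrix M N ∈ soSplit n := by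
  rw [inclusionMatrix_eq, fromBlocks_mem_soSplit_iff]
  refine ⟨rfl, ?_, ?_⟩
  · rw [transpose_smul, skewUnit_transpose, smul_neg]
  · rw [transpose_neg, transpose_smul, skewUnit_transpose, smul_neg]

/-- Since `K⁻¹ M K = -Mᵀ` for `M` in `𝔰𝔭(n)`, the matrix is `M ⊗ 1 + 1 ⊗ N` conjugated by `diag(1,
K⁻¹)`. The relations `k1`–`k4` express this. -/
theorem inclusionMatrix_lie {M M' : Matrix (Idx n) (Idx n) ℝ} {N N' : Matrix (Idx 1) (Idx 1) ℝ}
    (hM : M ∈ spR n) (hM' : M' ∈ spR n) (hN : N ∈ spR 1) (hN' : N' ∈ spR 1) :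
    inclusionMatrix (M * M' - M' * M) (N * N' - N' * N) =
      inclusionMatrix M N * inclusionMatrix M' N' - inclusionMatrix M' N' * inclusionMatrix M N := by
  have hd : ∀ {N : Matrix (Idx 1) (Idx 1) ℝ}, N ∈ spR 1 →
      N (.inr 0) (.inr 0) = -N (.inl 0) (.inl 0) := by
    intro N hN
    rw [← fromBlocks_toBlocks N, fromBlocks_mem_spR_iff] at hN
    exact congrFun (congrFun hN.1 0) 0
  have k1 := skewUnit_mul_transpose hM
  have k2 := skewUnit_mul_transpose hM'
  have k3 := transpose_mul_skewUnit hM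
  have k4 := transpose_mul_skewUnit hM'
  simp only [inclusionMatrix_eq, fromBlocks_multiply, sub_eq_add_neg (fromBlocks _ _ _ _),
    fromBlocks_neg, fromBlocks_add, fromBlocks_inj]
  simp only [Matrix.sub_apply, Matrix.mul_apply, Fintype.sum_sum_type, 
    Finset.univ_unique, Finset.sum_singleton, Fin.default_eq_zero, Fin.isValue, hd hN, hd hN']
  refine ⟨?_, ?_, ?_, ?_⟩
  · simp only [add_mul, mul_add, smul_mul_assoc, mul_smul_comm, one_mul, mul_one, mul_neg,
      skewUnit_mul_self]
    module
  · simp only [add_mul, mul_add, smul_mul_assoc, mul_smul_comm, one_mul, mul_one, mul_neg,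
      transpose_add, transpose_smul, transpose_one, k1, k2]
    module
  · simp only [add_mul, mul_add, smul_mul_assoc, mul_smul_comm, one_mul, mul_one, mul_neg, neg_mul,
      transpose_add, transpose_smul, transpose_one, k3, k4]
    module
  · simp only [add_mul, mul_add, smul_mul_assoc, mul_smul_comm, one_mul, mul_one, mul_neg, neg_mul,
      skewUnit_mul_self, transpose_add, transpose_smul, transpose_one, transpose_sub, transpose_mul]
    module

/-- The embedding of `𝔰𝔭(n, ℝ) ⊕ 𝔰𝔭(1, ℝ)` into `𝔰𝔬(2n, 2n)` given by `inclusionMatrix`. -/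
def stdEmbedding (n : ℕ) : SpSp n →ₗ⁅ℝ⁆ soSplit n where
  toFun x := ⟨inclusionMatrix x.1.1 x.2.1, inclusionMatrix_mem _ _⟩
  map_add' x y := by
    ext1
    change inclusionMatrix (x.1.1 + y.1.1) (x.2.1 + y.2.1) =
      inclusionMatrix x.1.1 x.2.1 + inclusionMatrix y.1.1 y.2.1
    simp only [inclusionMatrix_eq, fromBlocks_add, fromBlocks_inj, Matrix.add_apply, transpose_add,
      transpose_smul, transpose_one]
    refine ⟨?_, ?_, ?_, ?_⟩ <;> module
  map_smul' r x := by
    ext1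
    change inclusionMatrix (r • x.1.1) (r • x.2.1) = r • inclusionMatrix x.1.1 x.2.1
    simp only [inclusionMatrix_eq, fromBlocks_smul, fromBlocks_inj, Matrix.smul_apply,
      transpose_add, transpose_smul, transpose_one, smul_eq_mul]
    refine ⟨?_, ?_, ?_, ?_⟩ <;> module
  map_lie' {x y} := by
    ext1
    exact inclusionMatrix_lie x.1.2 y.1.2 x.2.2 y.2.2

theorem coe_stdEmbedding (x : SpSp n) :
    (stdEmbedding n x : Matrix (DIdx n) (DIdx n) ℝ) = inclusionMatrix x.1.1 x.2.1 := rfl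

theorem stdEmbedding_injective (hn : 0 < n) : Function.Injective (stdEmbedding n) := by
  rw [injective_iff_map_eq_zero]
  rintro ⟨⟨M, hM⟩, ⟨N, hN⟩⟩ h
  have h1 : inclusionMatrix M N = 0 := congrArg Subtype.val h
  rw [inclusionMatrix_eq, ← fromBlocks_zero, fromBlocks_inj] at h1
  obtain ⟨h11, h12, h21, -⟩ := h1
  let o : Fin n := ⟨0, hn⟩
  have hb : N (.inl 0) (.inr 0) = 0 := by
    simpa [skewUnit] using congrFun (congrFun h12 (.inl o)) (.inr o)
  have hc : N (.inr 0) (.inl 0) = 0 := by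
    simpa [skewUnit] using congrFun (congrFun h21 (.inl o)) (.inr o)
  have hN' := hN
  rw [← fromBlocks_toBlocks N, fromBlocks_mem_spR_iff] at hN'
  have hd : N (.inr 0) (.inr 0) = -N (.inl 0) (.inl 0) := congrFun (congrFun hN'.1 0) 0
  have hM' := hM
  rw [← fromBlocks_toBlocks M, fromBlocks_mem_spR_iff] at hM'
  have hMd : M (.inr o) (.inr o) = -M (.inl o) (.inl o) := congrFun (congrFun hM'.1 o) o
  have e1 : M (.inl o) (.inl o) + N (.inl 0) (.inl 0) = 0 := by
    simpa using congrFun (congrFun h11 (.inl o)) (.inl o)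
  have e2 : M (.inr o) (.inr o) + N (.inl 0) (.inl 0) = 0 := by
    simpa using congrFun (congrFun h11 (.inr o)) (.inr o)
  have ha : N (.inl 0) (.inl 0) = 0 := by linarith
  have hN0 : N = 0 := by
    ext i j
    rcases i with i | i <;> rcases j with j | j <;> rw [Subsingleton.elim i 0, Subsingleton.elim j 0]
    · exact ha
    · exact hb
    · exact hc
    · rw [hd, ha]; simp
  have hM0 : M = 0 := by rw [ha] at h11; simpa using h11
  subst hN0 hM0
  rfl

/-! ### The associative algebra generated by the standard embedding -/

/-- A Cartan element `Eᵢᵢ - Eᵢ'ᵢ'` and its square give the diagonal matrix units, and `Eₓₓ X E_yy`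
isolates the entry `x, y` of any `X` in `𝔰𝔭(n)`. -/
theorem single_mem_of_spR_le {S : Subalgebra ℝ (Matrix (Idx n) (Idx n) ℝ)}
    (hS : ∀ M ∈ spR n, M ∈ S) (x y : Idx n) : single x y (1 : ℝ) ∈ S := by
  have hdiag : ∀ x : Idx n, single x x (1 : ℝ) ∈ S := by
    have hH : ∀ i : Fin n, single (.inl i) (.inl i) (1 : ℝ) - single (.inr i) (.inr i) 1 ∈ S := by
      intro i
      convert hS _ (spGl (single i i 1)).2 using 1
      rw [coe_spGl, transpose_single]
      ext (a | a) (b | b) <;> simp [single_apply]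
    have hsq : ∀ i : Fin n, single (.inl i) (.inl i) (1 : ℝ) + single (.inr i) (.inr i) 1 ∈ S := by
      intro i
      convert S.mul_mem (hH i) (hH i) using 1
      simp [sub_mul, mul_sub]
    rintro (i | i)
    · convert S.smul_mem (S.add_mem (hsq i) (hH i)) (1 / 2 : ℝ) using 1
      module
    · convert S.smul_mem (S.sub_mem (hsq i) (hH i)) (1 / 2 : ℝ) using 1
      module
  obtain ⟨X, hX, hXxy⟩ : ∃ X ∈ spR n, X x y ≠ 0 := by
    rcases x with i | i <;> rcases y with j | j
    · exact ⟨_, (spGl (single i j 1)).2, by simp [coe_spGl]⟩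
    · refine ⟨_, (spUp (single i j 1)).2, ?_⟩
      simp only [coe_spUp, fromBlocks_apply₁₂, Matrix.add_apply, transpose_apply, single_apply]
      split_ifs <;> grind
    · refine ⟨_, (spLow (single i j 1)).2, ?_⟩
      simp only [coe_spLow, fromBlocks_apply₂₁, Matrix.add_apply, transpose_apply, single_apply]
      split_ifs <;> grind
    · exact ⟨_, (spGl (single j i 1)).2, by simp [coe_spGl]⟩
  have := S.smul_mem (S.mul_mem (S.mul_mem (hdiag x) (hS X hX)) (hdiag y)) (X x y)⁻¹
  convert this using 1
  rw [single_mul_mul_single, one_mul, mul_one, smul_single, smul_eq_mul, inv_mul_cancel₀ hXxy]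

theorem mem_of_spR_le {S : Subalgebra ℝ (Matrix (Idx n) (Idx n) ℝ)}
    (hS : ∀ M ∈ spR n, M ∈ S) (M : Matrix (Idx n) (Idx n) ℝ) : M ∈ S := by
  rw [matrix_eq_sum_single M]
  refine S.sum_mem fun i _ ↦ S.sum_mem fun j _ ↦ ?_
  rw [← mul_one (M i j), ← smul_eq_mul, ← smul_single]
  exact S.smul_mem (single_mem_of_spR_le hS i j) _

/-- The diagonal action of `2n × 2n` matrices on `ℝ⁴ⁿ = ℝ²ⁿ ⊗ ℝ²`. -/
def diagAction (n : ℕ) : Matrix (Idx n) (Idx n) ℝ →ₐ[ℝ] Matrix (DIdx n) (DIdx n) ℝ :=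
  AlgHom.ofLinearMap
    { toFun := fun X ↦ fromBlocks X 0 0 (-(skewUnit n * X * skewUnit n))
      map_add' := fun X Y ↦ by simp [fromBlocks_add, mul_add, add_mul, add_comm]
      map_smul' := fun r X ↦ by simp [fromBlocks_smul] }
    (by simp [skewUnit_mul_self])
    (fun X Y ↦ by simp [fromBlocks_multiply, mul_assoc, skewUnit_mul_skewUnit_mul])

theorem diagAction_apply (X : Matrix (Idx n) (Idx n) ℝ) :
    diagAction n X = fromBlocks X 0 0 (-(skewUnit n * X * skewUnit n)) := rfl

/-- The summand `𝔰𝔭(n)` generates `End ℝ²ⁿ`, acting diagonally, and `𝔰𝔭(1)` supplies the block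
idempotents and off-diagonal units of the factor `M₂(ℝ)`; products of these fill each block
separately. -/
theorem eq_top_of_stdEmbedding_mem {S : Subalgebra ℝ (Matrix (DIdx n) (DIdx n) ℝ)}
    (hS : ∀ x : SpSp n, (stdEmbedding n x : Matrix (DIdx n) (DIdx n) ℝ) ∈ S) : S = ⊤ := by
  have hL : ∀ X, diagAction n X ∈ S := by
    intro X
    refine mem_of_spR_le (S := S.comap (diagAction n)) (fun M hM ↦ ?_) X
    rw [Subalgebra.mem_comap]
    convert hS (⟨M, hM⟩, 0) using 1
    rw [coe_stdEmbedding, inclusionMatrix_eq, diagAction_apply]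
    have h1 := skewUnit_mul_transpose hM
    have h2 : skewUnit n * M * skewUnit n = Mᵀ := by
      rw [mul_assoc, ← neg_neg (M * skewUnit n), ← h1, mul_neg, ← mul_assoc, skewUnit_mul_self]
      simp
    simp [h2]
  have hN : ∀ a b c : ℝ, fromBlocks (a • 1) (b • skewUnit n) (-(c • skewUnit n)) (-(a • 1)) ∈ S := by
    intro a b c
    have hmem : fromBlocks (a • (1 : Matrix (Fin 1) (Fin 1) ℝ)) (b • 1) (c • 1) (-(a • 1)) ∈ spR 1 :=
      fromBlocks_mem_spR_iff.mpr (by simp)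
    convert hS (0, ⟨_, hmem⟩) using 1
    simp [coe_stdEmbedding, inclusionMatrix_eq]
  rw [eq_top_iff]
  intro Z _
  have hP1 : fromBlocks 1 0 0 0 ∈ S := by
    convert S.smul_mem (S.add_mem S.one_mem (hN 1 0 0)) (1 / 2 : ℝ) using 1
    rw [← fromBlocks_one (l := Idx n) (m := Idx n), fromBlocks_add, fromBlocks_smul, fromBlocks_inj]
    refine ⟨?_, ?_, ?_, ?_⟩ <;> module
  have hP2 : fromBlocks 0 0 0 1 ∈ S := by
    convert S.sub_mem S.one_mem hP1 using 1
    rw [← fromBlocks_one (l := Idx n) (m := Idx n), sub_eq_add_neg, fromBlocks_neg, fromBlocks_add]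
    simp
  have e11 := S.mul_mem (hL Z.toBlocks₁₁) hP1
  have e12 := S.mul_mem (hL (-(Z.toBlocks₁₂ * skewUnit n))) (hN 0 1 0)
  have e21 := S.mul_mem (hN 0 0 1) (hL (skewUnit n * Z.toBlocks₂₁))
  have e22 := S.mul_mem hP2 (hL (-(skewUnit n * Z.toBlocks₂₂ * skewUnit n)))
  have := S.add_mem (S.add_mem e11 e12) (S.add_mem e21 e22)
  convert this using 1
  conv_lhs => rw [← fromBlocks_toBlocks Z]
  simp [diagAction_apply, fromBlocks_multiply, fromBlocks_add, mul_assoc, skewUnit_mul_self,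
    skewUnit_mul_skewUnit_mul]

theorem eq_bot_or_eq_top_of_stdEmbedding_mulVec (U : Submodule ℝ (DIdx n → ℝ))
    (hU : ∀ x : SpSp n, ∀ v ∈ U, (stdEmbedding n x : Matrix (DIdx n) (DIdx n) ℝ) *ᵥ v ∈ U) :
    U = ⊥ ∨ U = ⊤ := by
  let S : Subalgebra ℝ (Matrix (DIdx n) (DIdx n) ℝ) :=
    { carrier := {M | ∀ v ∈ U, M *ᵥ v ∈ U}
      mul_mem' := fun {M N} hM hN v hv ↦ by
        rw [← mulVec_mulVec]; exact hM _ (hN v hv)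
      add_mem' := fun {M N} hM hN v hv ↦ by
        rw [add_mulVec]; exact U.add_mem (hM v hv) (hN v hv)
      algebraMap_mem' := fun r v hv ↦ by
        rw [Algebra.algebraMap_eq_smul_one, smul_mulVec, one_mulVec]; exact U.smul_mem r hv }
  have hS : S = ⊤ := eq_top_of_stdEmbedding_mem hU
  refine or_iff_not_imp_left.mpr fun hne ↦ ?_
  obtain ⟨v, hv, hv0⟩ := Submodule.exists_mem_ne_zero_of_ne_bot hne
  obtain ⟨k, hk⟩ := Function.ne_iff.mp hv0
  rw [eq_top_iff]
  intro w _
  -- This rank-one matrix sends `v` to the arbitrary vector `w`.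
  have : (vecMulVec w (Pi.single k (v k)⁻¹)) *ᵥ v ∈ U :=
    (hS ▸ Algebra.mem_top : vecMulVec w (Pi.single k (v k)⁻¹) ∈ S) v hv
  rw [vecMulVec_mulVec] at this
  simpa [inv_mul_cancel₀ hk] using this

theorem exists_eq_smul_one_of_commute {W : Matrix (DIdx n) (DIdx n) ℝ}
    (hW : ∀ x : SpSp n, Commute (stdEmbedding n x : Matrix (DIdx n) (DIdx n) ℝ) W) :
    ∃ r : ℝ, W = r • 1 := by
  have hS : Subalgebra.centralizer ℝ {W} = ⊤ := eq_top_of_stdEmbedding_mem fun x ↦ by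
    rw [Subalgebra.mem_centralizer_iff]
    rintro _ rfl
    exact (hW x).eq.symm
  obtain ⟨r, hr⟩ := mem_range_scalar_iff_commute_single'.mpr fun i j ↦ by
    have hM : single i j (1 : ℝ) ∈ Subalgebra.centralizer ℝ {W} := hS ▸ Algebra.mem_top
    exact (((Subalgebra.mem_centralizer_iff ℝ).mp hM) W rfl).symm
  exact ⟨r, by rw [← hr, scalar_apply, smul_one_eq_diagonal]⟩

end SplitInclusion

/-! ### An intertwiner with the standard embedding. -/

namespace SplitInclusion

open Module Matrix

variable {n : ℕ}

theorem mem_soSplit_iff {X : Matrix (DIdx n) (DIdx n) ℝ} :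
    X ∈ soSplit n ↔ Xᵀ * splitForm n = -(splitForm n * X) := by
  change _ ∈ skewAdjointMatricesLieSubalgebra _ ↔ _
  rw [mem_skewAdjointMatricesLieSubalgebra, mem_skewAdjointMatricesSubmodule,
    Matrix.IsSkewAdjoint, Matrix.IsAdjointPair, mul_neg]

theorem splitForm_mul_self : splitForm n * splitForm n = 1 := by
  simp [splitForm, LieAlgebra.Orthogonal.JD, fromBlocks_multiply]

theorem splitForm_transpose : (splitForm n)ᵀ = splitForm n := by
  simp [splitForm, LieAlgebra.Orthogonal.JD, fromBlocks_transpose]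

/-- A homomorphism into `𝔰𝔬(2n, 2n)` as a representation on `ℝ⁴ⁿ`. -/
noncomputable def toRep (φ : SpSp n →ₗ⁅ℝ⁆ soSplit n) : SpSp n →ₗ⁅ℝ⁆ End ℝ (DIdx n → ℝ) :=
  (lieEquivMatrix'.symm.toLieHom).comp ((soSplit n).incl.comp φ)

theorem toRep_apply (φ : SpSp n →ₗ⁅ℝ⁆ soSplit n) (x : SpSp n) (v : DIdx n → ℝ) :
    toRep φ x v = (φ x : Matrix (DIdx n) (DIdx n) ℝ) *ᵥ v := rfl

theorem toRep_injective {φ : SpSp n →ₗ⁅ℝ⁆ soSplit n} (hφ : Function.Injective φ) :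
    Function.Injective (toRep φ) :=
  fun _ _ h ↦ hφ (Subtype.ext (lieEquivMatrix'.symm.injective h))

/-- The bilinear form of `ℝ^{2n,2n}`. -/
noncomputable def splitBilin (n : ℕ) : LinearMap.BilinForm ℝ (DIdx n → ℝ) :=
  Matrix.toBilin' (splitForm n)

theorem splitBilin_apply (v w : DIdx n → ℝ) : splitBilin n v w = v ⬝ᵥ splitForm n *ᵥ w :=
  Matrix.toBilin'_apply' _ _ _

theorem splitBilin_comm (v w : DIdx n → ℝ) : splitBilin n v w = splitBilin n w v := by
  rw [splitBilin_apply, splitBilin_apply, dotProduct_mulVec, ← mulVec_transpose,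
    splitForm_transpose, dotProduct_comm]

theorem exists_splitBilin_ne_zero {v : DIdx n → ℝ} (hv : v ≠ 0) : ∃ w, splitBilin n v w ≠ 0 := by
  obtain ⟨k, hk⟩ := Function.ne_iff.mp hv
  refine ⟨splitForm n *ᵥ Pi.single k 1, ?_⟩
  rw [splitBilin_apply, mulVec_mulVec, splitForm_mul_self, one_mulVec]
  simpa using hk

theorem splitBilin_toRep (φ : SpSp n →ₗ⁅ℝ⁆ soSplit n) (x : SpSp n) (v w : DIdx n → ℝ) :
    splitBilin n (toRep φ x v) w = -splitBilin n v (toRep φ x w) := by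
  rw [splitBilin_apply, splitBilin_apply, toRep_apply, toRep_apply, mulVec_mulVec,
    ← vecMul_transpose, ← dotProduct_mulVec, mulVec_mulVec, mem_soSplit_iff.mp (φ x).2,
    neg_mulVec, dotProduct_neg]

theorem finrank_space : finrank ℝ (DIdx n → ℝ) = 4 * n := by
  simp
  ring

theorem exists_intertwiner (hn : 3 ≤ n) {φ : SpSp n →ₗ⁅ℝ⁆ soSplit n} (hφ : Function.Injective φ) :
    ∃ g : Matrix (DIdx n) (DIdx n) ℝ, g ≠ 0 ∧
      ∀ x, (φ x : Matrix (DIdx n) (DIdx n) ℝ) * g = g * (stdEmbedding n x).1 := by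
  let ρ : spR n →ₗ⁅ℝ⁆ End ℝ (DIdx n → ℝ) := (toRep φ).comp (LieHom.inl ℝ _ _)
  let σ : spR 1 →ₗ⁅ℝ⁆ End ℝ (DIdx n → ℝ) := (toRep φ).comp (LieHom.inr ℝ _ _)
  have hρσ : ∀ x y, Commute (σ y) (ρ x) := by
    intro x y
    rw [commute_iff_lie_eq]
    change ⁅toRep φ (0, y), toRep φ (x, 0)⁆ = 0
    rw [← LieHom.map_lie, LieAlgebra.Prod.bracket_apply]
    simp only [lie_zero, zero_lie]
    exact map_zero _
  have hV := finrank_space (n := n)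
  have R := spRelations ρ
  have S : StandardSp (fun i j ↦ ρ (spGl (single i j 1))) (fun i j ↦ ρ (spUp (single i j 1)))
      (fun i j ↦ ρ (spLow (single i j 1))) :=
    { R with
      cubed := R.diag_cubed hn hV.le
      orthogonal := fun i j ↦ R.diag_mul_diag hn hV.le }
  let o : Fin n := ⟨0, by lia⟩
  have hinj : ∀ x, toRep φ x = 0 → x = 0 := fun x hx ↦
    toRep_injective hφ (hx.trans (map_zero _).symm)
  have ha : ρ (spGl (single o o 1)) ≠ 0 := by
    intro h0
    have h1 := hinj (spGl (single o o 1), 0) h0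
    have h2 : (spGl (single o o 1)).1 = 0 := congrArg (fun x : SpSp n ↦ x.1.1) h1
    simpa [coe_spGl] using congrFun (congrFun h2 (.inl o)) (.inl o)
  have h2 := S.finrank_topSpace (by lia) hV (splitBilin n) splitBilin_comm
    (fun v ↦ exists_splitBilin_ne_zero) (o := o) (fun v w ↦ splitBilin_toRep φ _ v w)
    (fun v w ↦ splitBilin_toRep φ _ v w) ha
  have t := (spRelations σ).triple_diag 0
  have he0 : (1 / 2 : ℝ) • σ (spUp (single 0 0 1)) ≠ 0 := by
    intro h0
    rw [smul_eq_zero, or_iff_right (by norm_num)] at h0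
    have h1 := hinj (0, spUp (single 0 0 1)) h0
    have h2 : (spUp (single (0 : Fin 1) 0 1)).1 = 0 := congrArg (fun x : SpSp n ↦ x.2.1) h1
    have h3 := congrFun (congrFun h2 (.inl 0)) (.inr 0)
    simp [coe_spUp] at h3
  obtain ⟨u, hu, hu0, hfu, heu, hhu, hefu, hffu, hhfu⟩ := StandardSp.exists_sl_vector h2
    (S.assemble_surjective hV h2) t (fun _ _ ↦ hρσ _ _) (fun _ _ ↦ (hρσ _ _).smul_left _)
    (fun _ _ ↦ (hρσ _ _).smul_left _) (fun _ _ ↦ (hρσ _ _).smul_left _) he0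
  have hσ : ∀ (y : spR 1) (v : DIdx n → ℝ), σ y v =
      y.1 (.inl 0) (.inl 0) • σ (spGl (single 0 0 1)) v +
      y.1 (.inl 0) (.inr 0) • ((1 / 2 : ℝ) • σ (spUp (single 0 0 1))) v +
      y.1 (.inr 0) (.inl 0) • ((1 / 2 : ℝ) • σ (spLow (single 0 0 1))) v := by
    intro y v
    have hone : ∀ A : Matrix (Fin 1) (Fin 1) ℝ, A = A 0 0 • single 0 0 1 := by
      intro A
      ext i j
      rw [Subsingleton.elim i 0, Subsingleton.elim j 0]
      simp
    conv_lhs => rw [spR_eq_blocks y, hone (toBlocks₁₁ y.1), hone (toBlocks₁₂ y.1),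
      hone (toBlocks₂₁ y.1)]
    simp only [map_add, map_smul, LinearMap.add_apply, LinearMap.smul_apply, toBlocks₁₁,
      toBlocks₁₂, toBlocks₂₁, of_apply]
    module
  set f := (1 / 2 : ℝ) • σ (spLow (single 0 0 1)) with hf
  let T := StandardSp.transport (fun i j ↦ ρ (spGl (single i j 1)))
    (fun i j ↦ ρ (spLow (single i j 1))) o
  have hTσ : ∀ y z, Commute (σ y) (T z) := fun y z ↦
    StandardSp.commute_transport (fun _ _ ↦ hρσ _ _) (fun _ _ ↦ hρσ _ _) z
  -- `G v` is the matrix of the map `ℝ²ⁿ → V` determined by `v`; it intertwines `𝔰𝔭(n)` when `v` is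
  -- in `topSpace`, and `𝔰𝔭(1)` acts through `v`.
  let G : (DIdx n → ℝ) → Matrix (DIdx n) (Idx n) ℝ := fun v ↦ of fun r z ↦ T z v r
  have hGadd : ∀ v w, G (v + w) = G v + G w := fun v w ↦ by
    ext r z; simp [G]
  have hGsmul : ∀ (r : ℝ) v, G (r • v) = r • G v := fun r v ↦ by
    ext s z; simp [G]
  have hmul : ∀ (X : Matrix (DIdx n) (DIdx n) ℝ) v,
      X * G v = of fun r z ↦ (X *ᵥ T z v) r := fun X v ↦ rfl
  have hGρ : ∀ (x : spR n) v, v ∈ StandardSp.topSpace (fun i j ↦ ρ (spGl (single i j 1))) o →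
      (φ (x, 0)).1 * G v = G v * x.1 := by
    intro x v hv
    ext r z
    rw [hmul, of_apply, ← toRep_apply]
    have := congrFun (map_apply_transport ρ S hv x z) r
    refine this.trans ?_
    simp [Matrix.mul_apply, Finset.sum_apply, G, T, mul_comm]
  have hGσ : ∀ (y : spR 1) v, (φ (0, y)).1 * G v = G (σ y v) := by
    intro y v
    ext r z
    rw [hmul, of_apply, ← toRep_apply]
    exact congrFun (congrArg (· v) (hTσ y z).eq) r
  -- The pair `u`, `f u` identifies `V` with `ℝ²ⁿ ⊗ ℝ²`; the factor `K` matches the twist of the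
  -- second copy of `ℝ²ⁿ` in the standard embedding.
  let g := fromCols (G u) (G (f u) * skewUnit n)
  refine ⟨g, fun hg ↦ hu0 ?_, fun x ↦ ?_⟩
  · have h3 : T (.inl o) u = u := StandardSp.a_self_apply (StandardSp.mem_topSpace.mp hu)
    rw [← h3]
    ext r
    exact congrFun (congrFun hg r) (.inl (.inl o))
  · obtain ⟨x, y⟩ := x
    have hxy : (φ (x, y)).1 = (φ (x, 0)).1 + (φ (0, y)).1 := by
      have h : (x, y) = ((x, 0) + (0, y) : SpSp n) := by simp
      rw [h, map_add]
      rfl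
    obtain ⟨a, b, c, ha, hb, hc⟩ : ∃ a b c : ℝ, y.1 (.inl 0) (.inl 0) = a ∧
        y.1 (.inl 0) (.inr 0) = b ∧ y.1 (.inr 0) (.inl 0) = c := ⟨_, _, _, rfl, rfl, rfl⟩
    have hσy := hσ y
    rw [coe_stdEmbedding, inclusionMatrix_eq]
    simp only [ha, hb, hc] at hσy ⊢
    have e1 : (φ (x, y)).1 * G u = G u * x.1 + (a • G u + c • G (f u)) := by
      rw [hxy, Matrix.add_mul, hGρ x u hu, hGσ, hσy, hhu, heu, smul_zero, add_zero, hGadd, hGsmul,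
        hGsmul]
    have e2 : (φ (x, y)).1 * G (f u) = G (f u) * x.1 + (-(a • G (f u)) + b • G u) := by
      rw [hxy, Matrix.add_mul, hGρ x _ hfu, hGσ, hσy, hhfu, hefu, hffu, smul_zero, add_zero,
        hGadd, smul_neg, ← neg_smul, hGsmul, hGsmul, neg_smul]
    have k1 := skewUnit_mul_transpose x.2
    rw [fromCols_mul_fromBlocks, mul_fromCols, e1, ← Matrix.mul_assoc, e2]
    congr 1
    · simp only [Matrix.mul_add, Matrix.mul_smul, Matrix.mul_one, Matrix.mul_neg,
        Matrix.mul_assoc, skewUnit_mul_self]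
      module
    · simp only [Matrix.mul_add, Matrix.add_mul, Matrix.mul_smul, Matrix.smul_mul,
        Matrix.mul_one, Matrix.mul_neg, Matrix.neg_mul, Matrix.mul_assoc, transpose_add,
        transpose_smul, transpose_one, k1]
      module

end SplitInclusion

/-! ### From an intertwiner to isometries and anti-isometries. -/

namespace SplitInclusion

open Module Matrix

variable {n : ℕ}

/-- Schur's lemma: the kernel of `g` is invariant under the standard embedding. -/
theorem isUnit_of_intertwines {φ : SpSp n →ₗ⁅ℝ⁆ soSplit n} {g : Matrix (DIdx n) (DIdx n) ℝ}
    (hg0 : g ≠ 0)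
    (hg : ∀ x, (φ x : Matrix (DIdx n) (DIdx n) ℝ) * g = g * (stdEmbedding n x).1) : IsUnit g := by
  have h := eq_bot_or_eq_top_of_stdEmbedding_mulVec (LinearMap.ker g.mulVecLin) fun x v hv ↦ by
    rw [LinearMap.mem_ker, mulVecLin_apply] at hv ⊢
    rw [mulVec_mulVec, ← hg, ← mulVec_mulVec, hv, mulVec_zero]
  rcases h with h | h
  · rw [← Matrix.mulVec_injective_iff_isUnit]
    exact LinearMap.ker_eq_bot.mp h
  · rw [LinearMap.ker_eq_top] at h
    exact absurd (Matrix.toLin'.injective (h.trans (map_zero toLin').symm)) hg0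

/-- The matrix `g` multiplies the form of `ℝ^{2n,2n}` by the scalar `s`. -/
def HasMultiplier (s : ℝ) (g : GL (DIdx n) ℝ) : Prop :=
  g.1ᵀ * splitForm n * g.1 = s • splitForm n

theorem HasMultiplier.mul {s t : ℝ} {g h : GL (DIdx n) ℝ} (hg : HasMultiplier s g)
    (hh : HasMultiplier t h) : HasMultiplier (s * t) (g * h) := by
  unfold HasMultiplier at *
  calc (g.1 * h.1)ᵀ * splitForm n * (g.1 * h.1)
      = h.1ᵀ * (g.1ᵀ * splitForm n * g.1) * h.1 := by
        simp only [transpose_mul, Matrix.mul_assoc]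
    _ = (s * t) • splitForm n := by
        rw [hg, Matrix.mul_smul, Matrix.smul_mul, hh, smul_smul]

theorem HasMultiplier.inv {s : ℝ} {g : GL (DIdx n) ℝ} (hs : s * s = 1)
    (hg : HasMultiplier s g) : HasMultiplier s g⁻¹ := by
  unfold HasMultiplier at *
  have h1 : g.1 * g⁻¹.1 = 1 := g.mul_inv
  have h2 : g⁻¹.1ᵀ * g.1ᵀ = 1 := by rw [← transpose_mul, h1, transpose_one]
  calc g⁻¹.1ᵀ * splitForm n * g⁻¹.1
      = s • (g⁻¹.1ᵀ * (s • splitForm n) * g⁻¹.1) := by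
        rw [Matrix.mul_smul, Matrix.smul_mul, smul_smul, hs, one_smul]
    _ = s • ((g⁻¹.1ᵀ * g.1ᵀ) * splitForm n * (g.1 * g⁻¹.1)) := by
        rw [← hg]; simp only [Matrix.mul_assoc]
    _ = s • splitForm n := by rw [h1, h2, Matrix.one_mul, Matrix.mul_one]

theorem HasMultiplier.conj_mem {s : ℝ} {g : GL (DIdx n) ℝ} (hs : s * s = 1)
    (hg : HasMultiplier s g) {X : Matrix (DIdx n) (DIdx n) ℝ} (hX : X ∈ soSplit n) :
    g.1 * X * g⁻¹.1 ∈ soSplit n := by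
  have hi := hg.inv hs
  unfold HasMultiplier at hg hi
  rw [mem_soSplit_iff] at hX ⊢
  have h1 : g.1 * g⁻¹.1 = 1 := g.mul_inv
  have h2 : g⁻¹.1ᵀ * g.1ᵀ = 1 := by rw [← transpose_mul, h1, transpose_one]
  have e1 : g.1ᵀ * splitForm n = s • (splitForm n * g⁻¹.1) := by
    rw [← Matrix.smul_mul, ← hg, Matrix.mul_assoc, h1, Matrix.mul_one]
  have e2 : s • (g⁻¹.1ᵀ * splitForm n) = splitForm n * g.1 := by
    rw [← Matrix.mul_smul, ← hg, Matrix.mul_assoc, ← Matrix.mul_assoc, h2, Matrix.one_mul]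
  rw [transpose_mul, transpose_mul, Matrix.mul_assoc, Matrix.mul_assoc, e1, Matrix.mul_smul,
    ← Matrix.mul_assoc Xᵀ, hX, Matrix.neg_mul, smul_neg, Matrix.mul_neg, Matrix.mul_smul,
    Matrix.mul_assoc (splitForm n), ← Matrix.mul_assoc _ (splitForm n), ← Matrix.smul_mul, e2]
  simp only [Matrix.mul_assoc]

/-- Conjugation by a matrix that preserves the form of `ℝ^{2n,2n}` up to sign. -/
noncomputable def conjEquiv {s : ℝ} {g : GL (DIdx n) ℝ} (hs : s * s = 1)
    (hg : HasMultiplier s g) : soSplit n ≃ₗ⁅ℝ⁆ soSplit n where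
  toFun X := ⟨g.1 * X.1 * g⁻¹.1, hg.conj_mem hs X.2⟩
  invFun X := ⟨g⁻¹.1 * X.1 * g.1, by simpa using (hg.inv hs).conj_mem hs X.2⟩
  map_add' X Y := Subtype.ext <| by
    change g.1 * (X.1 + Y.1) * g⁻¹.1 = g.1 * X.1 * g⁻¹.1 + g.1 * Y.1 * g⁻¹.1
    rw [Matrix.mul_add, Matrix.add_mul]
  map_smul' r X := Subtype.ext <| by
    change g.1 * (r • X.1) * g⁻¹.1 = r • (g.1 * X.1 * g⁻¹.1)
    rw [Matrix.mul_smul, Matrix.smul_mul]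
  map_lie' {X Y} := Subtype.ext <| by
    change g.1 * (X.1 * Y.1 - Y.1 * X.1) * g⁻¹.1 =
      (g.1 * X.1 * g⁻¹.1) * (g.1 * Y.1 * g⁻¹.1) - (g.1 * Y.1 * g⁻¹.1) * (g.1 * X.1 * g⁻¹.1)
    simp only [mul_assoc, Units.inv_mul_cancel_left, mul_sub, sub_mul]
  left_inv X := Subtype.ext <| by
    change g⁻¹.1 * (g.1 * X.1 * g⁻¹.1) * g.1 = X.1
    simp only [mul_assoc, Units.inv_mul_cancel_left, Units.inv_mul, mul_one]
  right_inv X := Subtype.ext <| by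
    change g.1 * (g⁻¹.1 * X.1 * g.1) * g⁻¹.1 = X.1
    simp only [mul_assoc, Units.mul_inv_cancel_left, Units.mul_inv, mul_one]

/-- The adjoint of `g` for the split form is `J gᵀ J`, and since both embeddings are skew, `J gᵀ J
g` commutes with the standard one and is a scalar `r`. -/
theorem exists_conj_stdEmbedding (hn : 3 ≤ n) {φ : SpSp n →ₗ⁅ℝ⁆ soSplit n}
    (hφ : Function.Injective φ) :
    ∃ (s : ℝ) (g : GL (DIdx n) ℝ), (s = 1 ∨ s = -1) ∧ HasMultiplier s g ∧
      ∀ x, (φ x : Matrix (DIdx n) (DIdx n) ℝ) = g.1 * (stdEmbedding n x).1 * g⁻¹.1 := by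
  obtain ⟨g, hg0, hg⟩ := exists_intertwiner hn hφ
  have hgu := isUnit_of_intertwines hg0 hg
  have hW : ∀ x, Commute (stdEmbedding n x : Matrix (DIdx n) (DIdx n) ℝ)
      (splitForm n * gᵀ * splitForm n * g) := by
    intro x
    have h1 := mem_soSplit_iff.mp (φ x).2
    have h2 := mem_soSplit_iff.mp (stdEmbedding n x).2
    have h3 := congrArg transpose (hg x)
    simp only [transpose_mul] at h3
    have h4 : (stdEmbedding n x).1 * splitForm n = -(splitForm n * (stdEmbedding n x).1ᵀ) := by
      have h5 := congrArg (splitForm n * · * splitForm n) h2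
      simp only [Matrix.mul_neg, Matrix.neg_mul, Matrix.mul_assoc, splitForm_mul_self,
        Matrix.mul_one] at h5
      rw [h5, neg_neg, ← Matrix.mul_assoc, splitForm_mul_self, Matrix.one_mul]
    calc (stdEmbedding n x).1 * (splitForm n * gᵀ * splitForm n * g)
        = ((stdEmbedding n x).1 * splitForm n) * gᵀ * splitForm n * g := by
          simp only [Matrix.mul_assoc]
      _ = -(splitForm n * ((stdEmbedding n x).1ᵀ * gᵀ) * splitForm n * g) := by
          rw [h4]; simp only [Matrix.mul_assoc, Matrix.neg_mul]
      _ = -(splitForm n * gᵀ * ((φ x).1ᵀ * splitForm n) * g) := by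
          rw [← h3]; simp only [Matrix.mul_assoc]
      _ = splitForm n * gᵀ * splitForm n * ((φ x).1 * g) := by
          rw [h1]; simp only [Matrix.mul_assoc, Matrix.neg_mul, Matrix.mul_neg, neg_neg]
      _ = splitForm n * gᵀ * splitForm n * g * (stdEmbedding n x).1 := by
          rw [hg]; simp only [Matrix.mul_assoc]
  obtain ⟨r, hr⟩ := exists_eq_smul_one_of_commute hW
  have hgr : gᵀ * splitForm n * g = r • splitForm n := by
    calc gᵀ * splitForm n * g = splitForm n * (splitForm n * gᵀ * splitForm n * g) := by
          rw [Matrix.mul_assoc (splitForm n), Matrix.mul_assoc (splitForm n),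
            ← Matrix.mul_assoc (splitForm n), splitForm_mul_self, Matrix.one_mul]
      _ = r • splitForm n := by rw [hr, Matrix.mul_smul, Matrix.mul_one]
  have hr0 : r ≠ 0 := by
    rintro rfl
    rw [zero_smul] at hr
    have hJ : IsUnit (splitForm n) := IsUnit.of_mul_eq_one _ splitForm_mul_self
    have hgt : IsUnit gᵀ := (isUnit_transpose g).mpr hgu
    have := ((hJ.mul hgt).mul hJ).mul hgu
    rw [hr, isUnit_zero_iff] at this
    have h1 := congrFun (congrFun this (.inl (.inl ⟨0, by lia⟩))) (.inl (.inl ⟨0, by lia⟩))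
    simp at h1
  obtain ⟨u, rfl⟩ := hgu
  have hq : √|r| ≠ 0 := (Real.sqrt_pos.mpr (abs_pos.mpr hr0)).ne'
  -- Scaling `g` changes `r` by a square, so only its absolute value can be normalized and the sign
  -- `s` remains.
  let q : ℝˣ := Units.mk0 (√|r|)⁻¹ (inv_ne_zero hq)
  refine ⟨r / |r|, q • u, ?_, ?_, fun x ↦ ?_⟩
  · rcases abs_choice r with h | h <;> rw [h]
    · exact .inl (div_self hr0)
    · exact .inr (by field_simp)
  · change ((√|r|)⁻¹ • u.1)ᵀ * splitForm n * ((√|r|)⁻¹ • u.1) = _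
    rw [transpose_smul, Matrix.smul_mul, Matrix.smul_mul, Matrix.mul_smul, hgr, smul_smul,
      smul_smul, ← mul_inv, Real.mul_self_sqrt (abs_nonneg r), mul_comm, div_eq_mul_inv]
  · have h1 : (φ x).1 * (q • u).1 = (q • u).1 * (stdEmbedding n x).1 := by
      change (φ x).1 * ((√|r|)⁻¹ • u.1) = ((√|r|)⁻¹ • u.1) * (stdEmbedding n x).1
      rw [Matrix.mul_smul, Matrix.smul_mul, hg]
    rw [← h1, mul_assoc, Units.mul_inv, mul_one]

/-- The involution of `ℝ^{2n}` that changes the sign of the second block of coordinates. -/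
def signFlip (ι : Type*) [DecidableEq ι] : Matrix (ι ⊕ ι) (ι ⊕ ι) ℝ := fromBlocks 1 0 0 (-1)

section

variable {ι : Type*} [DecidableEq ι] [Fintype ι]

theorem signFlip_mul_self : signFlip ι * signFlip ι = 1 := by
  simp [signFlip, fromBlocks_multiply]

theorem signFlip_mul_fromBlocks_mul (A B C D : Matrix ι ι ℝ) :
    signFlip ι * fromBlocks A B C D * signFlip ι = fromBlocks A (-B) (-C) D := by
  simp [signFlip, fromBlocks_multiply]

end

theorem signFlip_conj_mem {N : Matrix (Idx n) (Idx n) ℝ} (hN : N ∈ spR n) :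
    signFlip (Fin n) * N * signFlip (Fin n) ∈ spR n := by
  rw [← fromBlocks_toBlocks N] at hN ⊢
  rw [signFlip_mul_fromBlocks_mul]
  rw [fromBlocks_mem_spR_iff] at hN ⊢
  simpa using hN

/-- Conjugation of `𝔰𝔭(n, ℝ)` by the matrix `[I, 0; 0, -I]`. -/
def spFlip (n : ℕ) : spR n ≃ₗ⁅ℝ⁆ spR n where
  toFun N := ⟨signFlip (Fin n) * N.1 * signFlip (Fin n), signFlip_conj_mem N.2⟩
  invFun N := ⟨signFlip (Fin n) * N.1 * signFlip (Fin n), signFlip_conj_mem N.2⟩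
  map_add' X Y := Subtype.ext <| by
    change signFlip (Fin n) * (X.1 + Y.1) * signFlip (Fin n) = _
    rw [Matrix.mul_add, Matrix.add_mul]
    rfl
  map_smul' r X := Subtype.ext <| by
    change signFlip (Fin n) * (r • X.1) * signFlip (Fin n) = _
    rw [Matrix.mul_smul, Matrix.smul_mul]
    rfl
  map_lie' {X Y} := Subtype.ext <| by
    have h : ∀ Z, signFlip (Fin n) * (signFlip (Fin n) * Z) = Z := fun Z ↦ by
      rw [← Matrix.mul_assoc, signFlip_mul_self, Matrix.one_mul]
    change signFlip (Fin n) * (X.1 * Y.1 - Y.1 * X.1) * signFlip (Fin n) =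
      (signFlip (Fin n) * X.1 * signFlip (Fin n)) * (signFlip (Fin n) * Y.1 * signFlip (Fin n)) -
      (signFlip (Fin n) * Y.1 * signFlip (Fin n)) * (signFlip (Fin n) * X.1 * signFlip (Fin n))
    simp only [Matrix.mul_assoc, h, Matrix.mul_sub, Matrix.sub_mul]
  left_inv X := Subtype.ext <| by
    change signFlip (Fin n) * (signFlip (Fin n) * X.1 * signFlip (Fin n)) * signFlip (Fin n) = _
    simp only [Matrix.mul_assoc, signFlip_mul_self, Matrix.mul_one]
    rw [← Matrix.mul_assoc, signFlip_mul_self, Matrix.one_mul]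
  right_inv X := Subtype.ext <| by
    change signFlip (Fin n) * (signFlip (Fin n) * X.1 * signFlip (Fin n)) * signFlip (Fin n) = _
    simp only [Matrix.mul_assoc, signFlip_mul_self, Matrix.mul_one]
    rw [← Matrix.mul_assoc, signFlip_mul_self, Matrix.one_mul]

/-- The automorphism of `𝔰𝔭(n, ℝ) ⊕ 𝔰𝔭(1, ℝ)` that flips the second summand. -/
def sourceFlip (n : ℕ) : SpSp n ≃ₗ⁅ℝ⁆ SpSp n where
  toFun x := (x.1, spFlip 1 x.2)
  invFun x := (x.1, (spFlip 1).symm x.2)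
  map_add' x y := Prod.ext rfl (map_add (spFlip 1) x.2 y.2)
  map_smul' r x := Prod.ext rfl (map_smul (spFlip 1) r x.2)
  map_lie' {x y} := Prod.ext rfl ((spFlip 1).map_lie x.2 y.2)
  left_inv x := Prod.ext rfl ((spFlip 1).symm_apply_apply x.2)
  right_inv x := Prod.ext rfl ((spFlip 1).apply_symm_apply x.2)

/-- The anti-isometry `[I, 0; 0, -I]` of `ℝ^{2n,2n}`. -/
def antiIsometry (n : ℕ) : GL (DIdx n) ℝ :=
  ⟨signFlip (Idx n), signFlip (Idx n), signFlip_mul_self, signFlip_mul_self⟩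

theorem hasMultiplier_antiIsometry : HasMultiplier (-1) (antiIsometry n) := by
  change (signFlip (Idx n))ᵀ * splitForm n * signFlip (Idx n) = _
  simp [signFlip, splitForm, LieAlgebra.Orthogonal.JD, fromBlocks_multiply, fromBlocks_transpose,
    fromBlocks_neg]

/-- Both sides change the sign of `b` and `c` only. Hence an anti-isometry can be traded for an
automorphism of the source. -/
theorem stdEmbedding_sourceFlip (x : SpSp n) :
    (stdEmbedding n (sourceFlip n x)).1 =
      (antiIsometry n).1 * (stdEmbedding n x).1 * (antiIsometry n)⁻¹.1 := by
  change _ = signFlip (Idx n) * _ * signFlip (Idx n)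
  obtain ⟨x, y⟩ := x
  have h1 : signFlip (Fin 1) * y.1 * signFlip (Fin 1) =
      fromBlocks (toBlocks₁₁ y.1) (-toBlocks₁₂ y.1) (-toBlocks₂₁ y.1) (toBlocks₂₂ y.1) := by
    conv_lhs => rw [← fromBlocks_toBlocks y.1]
    exact signFlip_mul_fromBlocks_mul _ _ _ _
  rw [coe_stdEmbedding, coe_stdEmbedding, inclusionMatrix_eq, inclusionMatrix_eq,
    signFlip_mul_fromBlocks_mul]
  change fromBlocks (x.1 + (signFlip (Fin 1) * y.1 * signFlip (Fin 1)) (.inl 0) (.inl 0) • 1)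
    ((signFlip (Fin 1) * y.1 * signFlip (Fin 1)) (.inl 0) (.inr 0) • skewUnit n)
    (-((signFlip (Fin 1) * y.1 * signFlip (Fin 1)) (.inr 0) (.inl 0) • skewUnit n))
    (-(x.1 + (signFlip (Fin 1) * y.1 * signFlip (Fin 1)) (.inl 0) (.inl 0) • 1)ᵀ) = _
  rw [h1]
  simp [toBlocks₁₁, toBlocks₁₂, toBlocks₂₁]

/-- For equal multipliers `h g⁻¹` is already an isometry; for opposite ones the anti-isometry
inserted between `h` and `g⁻¹` corrects the sign at the cost of `sourceFlip`. -/
theorem exists_isometry_conj {φ ψ : SpSp n →ₗ⁅ℝ⁆ soSplit n} {s t : ℝ} {g h : GL (DIdx n) ℝ}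
    (hs : s = 1 ∨ s = -1) (ht : t = 1 ∨ t = -1) (hg : HasMultiplier s g) (hh : HasMultiplier t h)
    (hφ : ∀ x, (φ x).1 = g.1 * (stdEmbedding n x).1 * g⁻¹.1)
    (hψ : ∀ x, (ψ x).1 = h.1 * (stdEmbedding n x).1 * h⁻¹.1) :
    ∃ (α : SpSp n ≃ₗ⁅ℝ⁆ SpSp n) (k : GL (DIdx n) ℝ), HasMultiplier 1 k ∧
      ∀ x, (ψ (α x)).1 = k.1 * (φ x).1 * k⁻¹.1 := by
  have hs' : s * s = 1 := by rcases hs with rfl | rfl <;> norm_num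
  have ht' : t * t = 1 := by rcases ht with rfl | rfl <;> norm_num
  by_cases hst : s = t
  · subst hst
    refine ⟨LieEquiv.refl, h * g⁻¹, hs' ▸ hh.mul (hg.inv hs'), fun x ↦ ?_⟩
    rw [LieEquiv.refl_apply, hψ, hφ]
    simp [mul_assoc]
  · have hst' : t * -1 * s = 1 := by
      rcases hs with rfl | rfl <;> rcases ht with rfl | rfl <;> simp_all
    refine ⟨sourceFlip n, h * antiIsometry n * g⁻¹,
      hst' ▸ (hh.mul hasMultiplier_antiIsometry).mul (hg.inv hs'), fun x ↦ ?_⟩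
    rw [hψ, stdEmbedding_sourceFlip, hφ]
    simp [mul_assoc]

theorem isIrreducible_of_conj (hn : 0 < n) {φ : SpSp n →ₗ⁅ℝ⁆ soSplit n} {g : GL (DIdx n) ℝ}
    (hφ : ∀ x, (φ x).1 = g.1 * (stdEmbedding n x).1 * g⁻¹.1) :
    LieModule.IsIrreducible ℝ (SpSp n) (ModuleVia φ) := by
  have : Nonempty (Fin n) := ⟨⟨0, hn⟩⟩
  have : Nontrivial (ModuleVia φ) := inferInstanceAs (Nontrivial (DIdx n → ℝ))
  refine LieModule.IsIrreducible.mk fun N hN ↦ ?_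
  let N' : Submodule ℝ (DIdx n → ℝ) := N.toSubmodule
  have hmem : ∀ v : DIdx n → ℝ, v ∈ N' ↔ (v : ModuleVia φ) ∈ N := fun v ↦ Iff.rfl
  have hmul : ∀ v : DIdx n → ℝ, g.1 *ᵥ (g⁻¹.1 *ᵥ v) = v := fun v ↦ by
    rw [mulVec_mulVec, Units.mul_inv, one_mulVec]
  have hinv : ∀ x : SpSp n, ∀ v ∈ N'.comap g.1.mulVecLin,
      (stdEmbedding n x).1 *ᵥ v ∈ N'.comap g.1.mulVecLin := by
    intro x v hv
    rw [Submodule.mem_comap, mulVecLin_apply] at hv ⊢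
    have h1 : (φ x).1 *ᵥ (g.1 *ᵥ v) ∈ N' := N.lie_mem (x := x) ((hmem _).mp hv)
    rw [hφ, mulVec_mulVec, mul_assoc, Units.inv_mul, mul_one] at h1
    rwa [mulVec_mulVec]
  rcases eq_bot_or_eq_top_of_stdEmbedding_mulVec _ hinv with h | h
  · have key : ∀ v : DIdx n → ℝ, v ∈ N' → v = 0 := fun v hv ↦ by
      have h1 : g⁻¹.1 *ᵥ v ∈ N'.comap g.1.mulVecLin := by
        rwa [Submodule.mem_comap, mulVecLin_apply, hmul]
      rw [h, Submodule.mem_bot] at h1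
      rw [← hmul v, h1, mulVec_zero]
    exact absurd ((LieSubmodule.eq_bot_iff N).mpr key) hN
  · have key : ∀ v : DIdx n → ℝ, v ∈ N' := fun v ↦ by
      have h1 : g⁻¹.1 *ᵥ v ∈ N'.comap g.1.mulVecLin := h ▸ Submodule.mem_top
      rwa [Submodule.mem_comap, mulVecLin_apply, hmul] at h1
    rw [← LieSubmodule.toSubmodule_eq_top]
    exact Submodule.eq_top_iff'.mpr key

end SplitInclusion

open SplitInclusion in
theorem mainTheorem7 (n : ℕ) (hn : 3 ≤ n) :
    -- existence, by the explicit embedding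
    (∃ ι : SpSp n →ₗ⁅ℝ⁆ ↥(soSplit n),
      (∀ x : SpSp n, (ι x : Matrix (DIdx n) (DIdx n) ℝ) = inclusionMatrix x.1.1 x.2.1) ∧
        Function.Injective ι) ∧
    -- uniqueness up to isomorphism
    (∀ φ ψ : SpSp n →ₗ⁅ℝ⁆ ↥(soSplit n), Function.Injective φ → Function.Injective ψ →
      -- up to an automorphism of the target, induced by a linear isometry or anti-isometry
      (∃ (θ : ↥(soSplit n) ≃ₗ⁅ℝ⁆ ↥(soSplit n)) (g : GL (DIdx n) ℝ),
        (g.1.transpose * splitForm n * g.1 = splitForm n ∨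
          g.1.transpose * splitForm n * g.1 = -splitForm n) ∧
        (∀ X : ↥(soSplit n), (θ X : Matrix (DIdx n) (DIdx n) ℝ) = g.1 * X.1 * g⁻¹.1) ∧
        ∀ x : SpSp n, θ (φ x) = ψ x) ∧
      -- up to a linear isometry and an automorphism of the source
      (∃ (α : SpSp n ≃ₗ⁅ℝ⁆ SpSp n) (g : GL (DIdx n) ℝ),
        g.1.transpose * splitForm n * g.1 = splitForm n ∧
        ∀ x : SpSp n, (ψ (α x) : Matrix (DIdx n) (DIdx n) ℝ) = g.1 * (φ x).1 * g⁻¹.1)) ∧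
    -- irreducibility of the resulting module
    (∀ φ : SpSp n →ₗ⁅ℝ⁆ ↥(soSplit n), Function.Injective φ →
      LieModule.IsIrreducible ℝ (SpSp n) (ModuleVia φ)) := by
  refine ⟨⟨stdEmbedding n, coe_stdEmbedding, stdEmbedding_injective (by lia)⟩,
    fun φ ψ hφ hψ ↦ ?_, fun φ hφ ↦ ?_⟩
  · obtain ⟨s, g, hs, hg, hφg⟩ := exists_conj_stdEmbedding hn hφ
    obtain ⟨t, h, ht, hh, hψh⟩ := exists_conj_stdEmbedding hn hψ
    have hs' : s * s = 1 := by rcases hs with rfl | rfl <;> norm_num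
    have ht' : t * t = 1 := by rcases ht with rfl | rfl <;> norm_num
    have hm := hh.mul (hg.inv hs')
    -- The conjugating matrix `h g⁻¹` has multiplier `t * s`, hence is an isometry or an
    -- anti-isometry.
    refine ⟨⟨conjEquiv (by rw [mul_mul_mul_comm, ht', hs', one_mul]) hm, h * g⁻¹, ?_,
      fun X ↦ rfl, fun x ↦ Subtype.ext ?_⟩, ?_⟩
    · unfold HasMultiplier at hm
      rw [hm]
      rcases hs with rfl | rfl <;> rcases ht with rfl | rfl <;> simp
    · change (h * g⁻¹).1 * (φ x).1 * (h * g⁻¹)⁻¹.1 = _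
      rw [hψh, hφg]
      simp [mul_assoc]
    · obtain ⟨α, k, hk, hα⟩ := exists_isometry_conj hs ht hg hh hφg hψh
      exact ⟨α, k, by simpa [HasMultiplier] using hk, hα⟩
  · obtain ⟨s, g, -, -, hg⟩ := exists_conj_stdEmbedding hn hφ
    exact isIrreducible_of_conj (by lia) hg
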